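/- Let $G$ be a second countable, locally compact Hausdorff groupoid with unit space $G^{0}$, range and source maps $r,s$, and a left Haar system $\{\lambda^{u}\}_{u\in G^{0}}$ (each $\lambda^u$ has support $G^{u}=r^{-1}(\{u\})$). Inner products are conjugate linear in the first variable and Hilbert spaces are separable. A $G$-Hilbert bundle is a continuous field $\mathfrak H=\{\mathfrak H^{u}\}_{u\in G^{0}}$ of Hilbert spaces over $G^{0}$ (in the sense of Dixmier) together with linear isometries $L_{x}$ of $\mathfrak H^{s(x)}$ onto $\mathfrak H^{r(x)}$ $(x\in G)$ such that $L_{xy}=L_xL_y$ whenever $s(x)=r(y)$ and such that, for all bounded continuous sections $\xi,\eta$ of $\mathfrak H$, the coefficient $(\xi,\eta)(x)=\langle L_{x}\xi(s(x)),\eta(r(x))\rangle$ is continuous on $G$. Let $B(G)$ be the set of all coefficients $(\xi,\eta)$, with $\xi,\eta$ bounded continuous sections of some $G$-Hilbert bundle. Let $P(G)$ be the set of all bounded continuous functions $\phi:G\to\mathbb C$ that are positive definite, that is, $$\iint \phi(y^{-1}x)f(y)\overline{f(x)}\,d\lambda^{u}(x)\,d\lambda^{u}(y)\ \ge\ 0\qquad\text{for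 all } u\in G^{0},\ f\in C_{c}(G).$$ Let $I_{2}=\{1,2\}\times\{1,2\}$ be the trivial (pair) groupoid, with $r(i,j)=i$, $s(i,j)=j$, $(i,j)(j,k)=(i,k)$, $(i,j)^{-1}=(j,i)$ and the discrete topology. The product groupoid $G\times I_{2}$ has unit space $G^{0}\times\{1,2\}$ and carries the Haar system $\lambda^{(u,i)}=\lambda^{u}\times(\delta_{i}\times\text{counting measure})$. Write $\phi^{*}(x)=\overline{\phi(x^{-1})}$. Then a function $\phi:G\to\mathbb C$ belongs to $B(G)$ if and only if there exist $F\in P(G\times I_{2})$ and $\rho,\tau\in P(G)$ such that for all $x\in G$ $$\begin{bmatrix}F(x,1,1)&F(x,1,2)\\ F(x,2,1)&F(x,2,2)\end{bmatrix}=\begin{bmatrix}\rho(x)&\phi(x)\\ \phi^{*}(x)&\tau(x)\end{bmatrix}.$$ -/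

import Mathlib

open MeasureTheory Topology
open scoped ComplexOrder ComplexConjugate

universe u v w

/-- A topological groupoid with arrow space `G` and unit space `X`. The product is a total function,
but only its values on composable pairs (those with `s x = r y`) are constrained or used.
Since `unit` is continuous and `r ∘ unit = id`, the unit space is homeomorphic to its image in `G`,
with which it is usually identified. -/
structure TopologicalGroupoid (X : Type u) (G : Type v)
    [TopologicalSpace X] [TopologicalSpace G] where
  /-- the range map -/
  r : G → X
  /-- the source map -/
  s : G → X
  /-- the unit at a point of the unit space -/
  unit : X → G
  /-- inversion -/
  inv : G → G
  /-- the product `x y`, meaningful when `s x = r y` -/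
  mul : G → G → G
  r_unit : ∀ a, r (unit a) = a
  s_unit : ∀ a, s (unit a) = a
  r_inv : ∀ x, r (inv x) = s x
  s_inv : ∀ x, s (inv x) = r x
  r_mul : ∀ x y, s x = r y → r (mul x y) = r x
  s_mul : ∀ x y, s x = r y → s (mul x y) = s y
  mul_assoc : ∀ x y z, s x = r y → s y = r z → mul (mul x y) z = mul x (mul y z)
  unit_mul : ∀ x, mul (unit (r x)) x = x
  mul_unit : ∀ x, mul x (unit (s x)) = x
  inv_mul : ∀ x, mul (inv x) x = unit (s x)
  mul_inv : ∀ x, mul x (inv x) = unit (r x)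
  continuous_r : Continuous r
  continuous_s : Continuous s
  continuous_unit : Continuous unit
  continuous_inv : Continuous inv
  continuousOn_mul : ContinuousOn (fun p : G × G => mul p.1 p.2) {p | s p.1 = r p.2}

namespace TopologicalGroupoid

/-- The trivial (pair) groupoid `ι × ι`: `r (i, j) = i`, `s (i, j) = j`, `(i, j) (j, l) = (i, l)`. -/
def pair (ι : Type u) [TopologicalSpace ι] : TopologicalGroupoid ι (ι × ι) where
  r p := p.1
  s p := p.2
  unit i := (i, i)
  inv p := (p.2, p.1)
  mul p q := (p.1, q.2)
  r_unit _ := rfl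
  s_unit _ := rfl
  r_inv _ := rfl
  s_inv _ := rfl
  r_mul _ _ _ := rfl
  s_mul _ _ _ := rfl
  mul_assoc _ _ _ _ _ := rfl
  unit_mul _ := rfl
  mul_unit _ := rfl
  inv_mul _ := rfl
  mul_inv _ := rfl
  continuous_r := by fun_prop
  continuous_s := by fun_prop
  continuous_unit := by fun_prop
  continuous_inv := by fun_prop
  continuousOn_mul := by fun_prop

/-- The product of two topological groupoids, with componentwise operations. -/
def prod {X Y : Type*} {G H : Type*} [TopologicalSpace X] [TopologicalSpace Y]
    [TopologicalSpace G] [TopologicalSpace H]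
    (𝒢 : TopologicalGroupoid X G) (ℋ : TopologicalGroupoid Y H) :
    TopologicalGroupoid (X × Y) (G × H) where
  r p := (𝒢.r p.1, ℋ.r p.2)
  s p := (𝒢.s p.1, ℋ.s p.2)
  unit a := (𝒢.unit a.1, ℋ.unit a.2)
  inv p := (𝒢.inv p.1, ℋ.inv p.2)
  mul p q := (𝒢.mul p.1 q.1, ℋ.mul p.2 q.2)
  r_unit a := Prod.ext (𝒢.r_unit _) (ℋ.r_unit _)
  s_unit a := Prod.ext (𝒢.s_unit _) (ℋ.s_unit _)
  r_inv p := Prod.ext (𝒢.r_inv _) (ℋ.r_inv _)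
  s_inv p := Prod.ext (𝒢.s_inv _) (ℋ.s_inv _)
  r_mul p q h := Prod.ext (𝒢.r_mul _ _ (Prod.ext_iff.1 h).1) (ℋ.r_mul _ _ (Prod.ext_iff.1 h).2)
  s_mul p q h := Prod.ext (𝒢.s_mul _ _ (Prod.ext_iff.1 h).1) (ℋ.s_mul _ _ (Prod.ext_iff.1 h).2)
  mul_assoc p q t h h' := Prod.ext
    (𝒢.mul_assoc _ _ _ (Prod.ext_iff.1 h).1 (Prod.ext_iff.1 h').1)
    (ℋ.mul_assoc _ _ _ (Prod.ext_iff.1 h).2 (Prod.ext_iff.1 h').2)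
  unit_mul p := Prod.ext (𝒢.unit_mul _) (ℋ.unit_mul _)
  mul_unit p := Prod.ext (𝒢.mul_unit _) (ℋ.mul_unit _)
  inv_mul p := Prod.ext (𝒢.inv_mul _) (ℋ.inv_mul _)
  mul_inv p := Prod.ext (𝒢.mul_inv _) (ℋ.mul_inv _)
  continuous_r :=
    (𝒢.continuous_r.comp continuous_fst).prodMk (ℋ.continuous_r.comp continuous_snd)
  continuous_s :=
    (𝒢.continuous_s.comp continuous_fst).prodMk (ℋ.continuous_s.comp continuous_snd)
  continuous_unit :=
    (𝒢.continuous_unit.comp continuous_fst).prodMk (ℋ.continuous_unit.comp continuous_snd)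
  continuous_inv :=
    (𝒢.continuous_inv.comp continuous_fst).prodMk (ℋ.continuous_inv.comp continuous_snd)
  continuousOn_mul :=
    (𝒢.continuousOn_mul.comp (f := fun p : (G × H) × (G × H) => (p.1.1, p.2.1)) (by fun_prop)
      (fun p (h : (𝒢.s p.1.1, ℋ.s p.1.2) = (𝒢.r p.2.1, ℋ.r p.2.2)) =>
        (Prod.ext_iff.1 h).1)).prodMk
    (ℋ.continuousOn_mul.comp (f := fun p : (G × H) × (G × H) => (p.1.2, p.2.2)) (by fun_prop)
      (fun p (h : (𝒢.s p.1.1, ℋ.s p.1.2) = (𝒢.r p.2.1, ℋ.r p.2.2)) =>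
        (Prod.ext_iff.1 h).2))

/-- A left Haar system: for each unit `a`, a (locally finite, Borel) measure `haar a` on `G`,
concentrated on the fibre `r⁻¹ {a}` and with support the whole of that fibre, depending continuously
on `a` and left invariant. When `G` is locally compact, Hausdorff and second countable, measures
that are finite on compact sets are automatically regular. -/
structure IsHaarSystem {X : Type u} {G : Type v} [TopologicalSpace X] [TopologicalSpace G]
    [MeasurableSpace G] (𝒢 : TopologicalGroupoid X G) (haar : X → Measure G) : Prop where
  finite_on_compacts : ∀ a, ∀ K : Set G, IsCompact K → haar a K < ⊤
  concentrated : ∀ a, haar a {x | 𝒢.r x ≠ a} = 0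
  support_eq : ∀ a, (haar a).support = {x | 𝒢.r x = a}
  continuous_integral : ∀ f : G → ℂ, Continuous f → HasCompactSupport f →
    Continuous fun a => ∫ x, f x ∂(haar a)
  left_invariant : ∀ f : G → ℂ, Continuous f → HasCompactSupport f →
    ∀ x, ∫ z, f (𝒢.mul x z) ∂(haar (𝒢.s x)) = ∫ y, f y ∂(haar (𝒢.r x))

/-- The Haar system on the pair groupoid of a finite discrete set: counting measure on each
fibre `{i} × ι`. -/
noncomputable def pairHaar (ι : Type u) [MeasurableSpace ι] : ι → Measure (ι × ι) :=
  fun i => (Measure.dirac i).prod Measure.count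

/-- The product of two Haar systems, `(a, b) ↦ haar a × haar' b`. -/
noncomputable def prodHaar {X Y G H : Type*} [MeasurableSpace G] [MeasurableSpace H]
    (haar : X → Measure G) (haar' : Y → Measure H) : X × Y → Measure (G × H) :=
  fun a => (haar a.1).prod (haar' a.2)

section ProductHaar

set_option linter.unusedSectionVars false

variable {X : Type u} {G : Type v} [TopologicalSpace X] [TopologicalSpace G]
    [LocallyCompactSpace G] [T2Space G] [SecondCountableTopology G]
    [MeasurableSpace G] [BorelSpace G]
    {𝒢 : TopologicalGroupoid X G} {haar : X → Measure G}

theorem isClosed_fiber (𝒢 : TopologicalGroupoid X G) (a : X) : IsClosed {x | 𝒢.r x = a} := by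
  have : {x | 𝒢.r x = a} = {x | 𝒢.unit (𝒢.r x) = 𝒢.unit a} := by
    ext x
    refine ⟨fun h => congrArg _ h, fun h => ?_⟩
    have := congrArg 𝒢.r h
    simpa [𝒢.r_unit] using this
  rw [this]
  exact isClosed_eq (𝒢.continuous_unit.comp 𝒢.continuous_r) continuous_const

theorem IsHaarSystem.ae_fiber (h : 𝒢.IsHaarSystem haar) (a : X) : ∀ᵐ x ∂(haar a), 𝒢.r x = a :=
  h.concentrated a

theorem IsHaarSystem.finiteOnCompacts (h : 𝒢.IsHaarSystem haar) (a : X) :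
    IsFiniteMeasureOnCompacts (haar a) := ⟨fun {K} hK => h.finite_on_compacts a K hK⟩

theorem IsHaarSystem.integrable_translate (h : 𝒢.IsHaarSystem haar) {f : G → ℂ}
    (hf : Continuous f) (hc : HasCompactSupport f) (x : G) :
    Integrable (fun z => f (𝒢.mul x z)) (haar (𝒢.s x)) := by
  have := h.finiteOnCompacts (𝒢.s x)
  set S : Set G := {z | 𝒢.r z = 𝒢.s x} with hS
  have hSc : IsClosed S := 𝒢.isClosed_fiber _
  have hcont : ContinuousOn (fun z => f (𝒢.mul x z)) S :=
    hf.comp_continuousOn (𝒢.continuousOn_mul.comp (f := fun z => (x, z)) (by fun_prop)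
      (fun z (hz : 𝒢.r z = 𝒢.s x) => hz.symm))
  have hres : (haar (𝒢.s x)).restrict S = haar (𝒢.s x) :=
    Measure.restrict_eq_self_of_ae_mem (h.ae_fiber _)
  set K : Set G := (fun w => 𝒢.mul (𝒢.inv x) w) '' (tsupport f ∩ {w | 𝒢.r w = 𝒢.r x}) with hK
  have hKc : IsCompact K := by
    refine (hc.isCompact.inter_right (𝒢.isClosed_fiber _)).image_of_continuousOn ?_
    refine 𝒢.continuousOn_mul.comp (f := fun w => (𝒢.inv x, w)) (by fun_prop) ?_
    rintro w ⟨-, hw⟩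
    exact (𝒢.s_inv x).trans hw.symm
  have hzero : ∀ z ∈ S, z ∉ K → f (𝒢.mul x z) = 0 := by
    intro z hz hzK
    by_contra hne
    refine hzK ⟨𝒢.mul x z, ⟨subset_tsupport _ hne, 𝒢.r_mul x z hz.symm⟩, ?_⟩
    change 𝒢.mul (𝒢.inv x) (𝒢.mul x z) = z
    rw [← 𝒢.mul_assoc _ _ _ (𝒢.s_inv x) hz.symm, 𝒢.inv_mul]
    have : 𝒢.s x = 𝒢.r z := hz.symm
    rw [this, 𝒢.unit_mul]
  have hon : IntegrableOn (fun z => f (𝒢.mul x z)) (S ∩ K) (haar (𝒢.s x)) := by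
    refine ContinuousOn.integrableOn_compact (hKc.inter_left hSc) (hcont.mono Set.inter_subset_left)
  have hon' : IntegrableOn (fun z => f (𝒢.mul x z)) S (haar (𝒢.s x)) :=
    hon.of_forall_sdiff_eq_zero hSc.measurableSet (fun z hz => hzero z hz.1 fun hzk => hz.2 ⟨hz.1, hzk⟩)
  rwa [IntegrableOn, hres] at hon'

theorem prodHaar_pairHaar (h : 𝒢.IsHaarSystem haar) (a : X) (i : Fin 2) :
    prodHaar haar (pairHaar (Fin 2)) (a, i) =
      ∑ j : Fin 2, (haar a).map (fun x => (x, (i, j))) := by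
  have := h.finiteOnCompacts a
  have hc : (Measure.count : Measure (Fin 2)) = Measure.dirac 0 + Measure.dirac 1 := by
    simp [Measure.count, Measure.sum_fintype, Fin.sum_univ_two]
  simp [prodHaar, pairHaar, hc, Measure.prod_add, Measure.prod_dirac, Fin.sum_univ_two]

theorem integral_prodHaar (h : 𝒢.IsHaarSystem haar) (a : X) (i : Fin 2)
    (f : G × (Fin 2 × Fin 2) → ℂ) (hf : ∀ j, Integrable (fun x => f (x, (i, j))) (haar a)) :
    ∫ p, f p ∂(prodHaar haar (pairHaar (Fin 2)) (a, i)) =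
      ∑ j : Fin 2, ∫ x, f (x, (i, j)) ∂(haar a) := by
  have hm : ∀ j : Fin 2, MeasurableEmbedding (fun x : G => (x, ((i, j) : Fin 2 × Fin 2))) :=
    fun j => measurableEmbedding_prod_mk_right _
  rw [prodHaar_pairHaar h, integral_finsetSum_measure]
  · exact Finset.sum_congr rfl fun j _ => (hm j).integral_map _
  · exact fun j _ => (hm j).integrable_map_iff.2 (hf j)

/-- The product system on `G × I₂` is again a Haar system. -/
theorem IsHaarSystem.prod_pair (h : 𝒢.IsHaarSystem haar) :
    (𝒢.prod (pair (Fin 2))).IsHaarSystem (prodHaar haar (pairHaar (Fin 2))) := by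
  have hm : ∀ i j : Fin 2, MeasurableEmbedding (fun x : G => (x, ((i, j) : Fin 2 × Fin 2))) :=
    fun i j => measurableEmbedding_prod_mk_right _
  have hsec : ∀ f : G × (Fin 2 × Fin 2) → ℂ, Continuous f → HasCompactSupport f → ∀ q,
      Continuous (fun x => f (x, q)) ∧ HasCompactSupport (fun x => f (x, q)) := by
    intro f hf hc q
    refine ⟨by fun_prop, HasCompactSupport.intro (hc.isCompact.image continuous_fst) ?_⟩
    intro x hx
    by_contra hne
    exact hx ⟨(x, q), subset_tsupport _ hne, rfl⟩
  refine ⟨?_, ?_, ?_, ?_, ?_⟩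
  · rintro ⟨a, i⟩ K hK
    rw [prodHaar_pairHaar h]
    simp only [Measure.coe_finsetSum, Finset.sum_apply, ENNReal.sum_lt_top]
    intro j _
    rw [(hm i j).map_apply]
    refine lt_of_le_of_lt (measure_mono ?_) (h.finite_on_compacts a _ (hK.image continuous_fst))
    exact fun x hx => ⟨_, hx, rfl⟩
  · rintro ⟨a, i⟩
    rw [prodHaar_pairHaar h]
    simp only [Measure.coe_finsetSum, Finset.sum_apply, Finset.sum_eq_zero_iff]
    intro j _
    rw [(hm i j).map_apply]
    refine measure_mono_null ?_ (h.concentrated a)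
    intro x hx hxa
    exact hx (Prod.ext hxa rfl)
  · rintro ⟨a, i⟩
    rw [prodHaar_pairHaar h]
    have key : ∀ (x : G) (k l : Fin 2),
        (x, (k, l)) ∈ (∑ j : Fin 2, (haar a).map (fun x => (x, (i, j)))).support ↔
        k = i ∧ x ∈ (haar a).support := by
      intro x k l
      rw [Measure.mem_support_iff_forall, Measure.mem_support_iff_forall]
      simp only [Measure.coe_finsetSum, Finset.sum_apply, (hm i _).map_apply]
      constructor
      · intro H
        constructor
        · by_contra hk
          have := H (Set.univ ×ˢ {(k, l)}) (prod_mem_nhds Filter.univ_mem (by simp))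
          have hk' : i ≠ k := fun h => hk h.symm
          simp [Set.preimage, hk'] at this
        · intro U hU
          have := H (U ×ˢ {(k, l)}) (prod_mem_nhds hU (by simp))
          obtain ⟨j, -, hj⟩ := (Finset.sum_pos_iff).1 this
          exact lt_of_lt_of_le hj (measure_mono fun y hy => hy.1)
      · rintro ⟨rfl, hx⟩ V hV
        refine lt_of_lt_of_le (hx ((fun x => (x, (k, l))) ⁻¹' V)
          ((by fun_prop : Continuous fun x : G => (x, ((k, l) : Fin 2 × Fin 2))).continuousAt.preimage_mem_nhds hV))
          (Finset.single_le_sum (f := fun j => haar a ((fun x => (x, (k, j))) ⁻¹' V))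
            (fun _ _ => zero_le) (Finset.mem_univ l))
    ext ⟨x, k, l⟩
    rw [key, h.support_eq]
    change k = i ∧ 𝒢.r x = a ↔ (𝒢.r x, k) = (a, i)
    rw [Prod.mk.injEq, and_comm]
  · intro f hf hc
    have : (fun a : X × Fin 2 => ∫ x, f x ∂(prodHaar haar (pairHaar (Fin 2)) a)) =
        fun a => ∑ j : Fin 2, ∫ x, f (x, (a.2, j)) ∂(haar a.1) := by
      ext ⟨a, i⟩
      have := h.finiteOnCompacts a
      exact integral_prodHaar h a i f fun j =>
        (hsec f hf hc (i, j)).1.integrable_of_hasCompactSupport (hsec f hf hc (i, j)).2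
    rw [this]
    refine continuous_finsetSum _ fun j _ => ?_
    refine continuous_prod_of_discrete_right.2 fun i => ?_
    exact h.continuous_integral _ (hsec f hf hc (i, j)).1 (hsec f hf hc (i, j)).2
  · rintro f hf hc ⟨x, k, l⟩
    have := h.finiteOnCompacts (𝒢.r x)
    refine (integral_prodHaar h (𝒢.s x) l
      (fun z => f ((𝒢.prod (pair (Fin 2))).mul (x, k, l) z)) fun j =>
        h.integrable_translate (hsec f hf hc (k, j)).1 (hsec f hf hc (k, j)).2 x).trans ?_
    refine Eq.trans ?_ (integral_prodHaar h (𝒢.r x) k f fun j =>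
        (hsec f hf hc (k, j)).1.integrable_of_hasCompactSupport (hsec f hf hc (k, j)).2).symm
    exact Finset.sum_congr rfl fun j _ =>
      h.left_invariant _ (hsec f hf hc (k, j)).1 (hsec f hf hc (k, j)).2 x

end ProductHaar

/-- `φ ∈ P(G)`: `φ` is a bounded continuous function on `G` that is positive definite,
`∬ φ(y⁻¹x) f(y) conj (f(x)) dλᵃ(x) dλᵃ(y) ≥ 0` for every unit `a` and every `f ∈ C_c(G)`.
(The order on `ℂ`: `0 ≤ z` means that `z` is real and nonnegative.) -/
def IsPositiveDefinite {X : Type u} {G : Type v} [TopologicalSpace X] [TopologicalSpace G]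
    [MeasurableSpace G] (𝒢 : TopologicalGroupoid X G) (haar : X → Measure G)
    (φ : G → ℂ) : Prop :=
  Continuous φ ∧ (∃ C : ℝ, ∀ x, ‖φ x‖ ≤ C) ∧
    ∀ a : X, ∀ f : G → ℂ, Continuous f → HasCompactSupport f →
      0 ≤ ∫ y, ∫ x, φ (𝒢.mul (𝒢.inv y) x) * f y * conj (f x) ∂(haar a) ∂(haar a)

/-- The function `φ*(x) = conj (φ(x⁻¹))`. -/
def adjoint {X : Type u} {G : Type v} [TopologicalSpace X] [TopologicalSpace G]
    (𝒢 : TopologicalGroupoid X G) (φ : G → ℂ) : G → ℂ :=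
  fun x => conj (φ (𝒢.inv x))

end TopologicalGroupoid

/-- A continuous Hilbert bundle over `X`, that is, a continuous field of (separable, complex) Hilbert
spaces in the sense of Dixmier: a family of Hilbert spaces together with a linear space of
sections, the continuous ones, which is fibrewise dense, consists of sections with
continuous norm, and is closed under local uniform approximation. -/
structure HilbertBundle (X : Type u) [TopologicalSpace X] where
  /-- the fibre over a point -/
  fiber : X → Type w
  [normedAddCommGroup : ∀ a, NormedAddCommGroup (fiber a)]
  [innerProductSpace : ∀ a, InnerProductSpace ℂ (fiber a)]
  [completeSpace : ∀ a, CompleteSpace (fiber a)]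
  [separableSpace : ∀ a, TopologicalSpace.SeparableSpace (fiber a)]
  /-- the continuous sections -/
  sections : Submodule ℂ (∀ a, fiber a)
  dense_sections : ∀ a, Dense {e : fiber a | ∃ ξ ∈ sections, ξ a = e}
  continuous_norm : ∀ ξ ∈ sections, Continuous fun a => ‖ξ a‖
  mem_of_locally_approx : ∀ ξ : ∀ a, fiber a,
    (∀ a, ∀ ε : ℝ, 0 < ε → ∃ η ∈ sections, ∀ᶠ b in 𝓝 a, ‖ξ b - η b‖ ≤ ε) → ξ ∈ sections

attribute [instance] HilbertBundle.normedAddCommGroup HilbertBundle.innerProductSpace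
  HilbertBundle.completeSpace HilbertBundle.separableSpace

/-- The space `Δ_b` of bounded continuous sections. -/
def HilbertBundle.boundedSections {X : Type u} [TopologicalSpace X] (E : HilbertBundle.{u, w} X) :
    Set (∀ a, E.fiber a) :=
  {ξ | ξ ∈ E.sections ∧ ∃ C : ℝ, ∀ a, ‖ξ a‖ ≤ C}

/-- A `G`-Hilbert bundle: a continuous Hilbert bundle over the unit space with surjective linear
isometries `L x` from the fibre over `s x` onto the fibre over `r x`, multiplicative in `x`, such
that `x ↦ ⟪L x (ξ (s x)), η (r x)⟫` is continuous for all bounded continuous sections `ξ`, `η`.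
The end points of `x` are passed to `L` together with proofs, `L x (_ : s x = a) (_ : r x = b)`, so
that the multiplicativity can be stated without transport between fibres. -/
structure GHilbertBundle {X : Type u} {G : Type v} [TopologicalSpace X] [TopologicalSpace G]
    (𝒢 : TopologicalGroupoid X G) extends HilbertBundle.{u, w} X where
  /-- the action of `G` -/
  L : ∀ (x : G) {a b : X}, 𝒢.s x = a → 𝒢.r x = b → (fiber a ≃ₗᵢ[ℂ] fiber b)
  L_mul : ∀ (x y : G) {a b c : X} (hya : 𝒢.s y = a) (hyb : 𝒢.r y = b) (hxb : 𝒢.s x = b)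
    (hxc : 𝒢.r x = c) (e : fiber a),
    L (𝒢.mul x y) ((𝒢.s_mul x y (hxb.trans hyb.symm)).trans hya)
      ((𝒢.r_mul x y (hxb.trans hyb.symm)).trans hxc) e = L x hxb hxc (L y hya hyb e)
  continuous_coefficient : ∀ ξ ∈ toHilbertBundle.boundedSections,
    ∀ η ∈ toHilbertBundle.boundedSections,
    Continuous fun x => inner ℂ (L x rfl rfl (ξ (𝒢.s x))) (η (𝒢.r x))

/-- The coefficient `(ξ, η)` of a `G`-Hilbert bundle, `x ↦ ⟪L x (ξ (s x)), η (r x)⟫`; the inner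
product is conjugate linear in the first variable. -/
noncomputable def GHilbertBundle.coefficient {X : Type u} {G : Type v} [TopologicalSpace X]
    [TopologicalSpace G] {𝒢 : TopologicalGroupoid X G} (E : GHilbertBundle.{u, v, w} 𝒢)
    (ξ η : ∀ a, E.fiber a) : G → ℂ :=
  fun x => inner ℂ (E.L x rfl rfl (ξ (𝒢.s x))) (η (𝒢.r x))

/-- The Fourier-Stieltjes algebra `B(G)`, as a set of functions: all coefficients `(ξ, η)` of
`G`-Hilbert bundles, with `ξ`, `η` bounded continuous sections. As the fibres are separable, it is no
restriction that they live in the universe of `G`. -/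
def fourierStieltjes {X : Type u} {G : Type v} [TopologicalSpace X] [TopologicalSpace G]
    (𝒢 : TopologicalGroupoid X G) : Set (G → ℂ) :=
  {φ | ∃ E : GHilbertBundle.{u, v, v} 𝒢, ∃ ξ ∈ E.boundedSections, ∃ η ∈ E.boundedSections,
    φ = E.coefficient ξ η}

/-! The indices `0`, `1` play the roles of 1, 2. If `φ = (ξ, η)`, put `ξ₀ = η`, `ξ₁ = ξ` and let `F
(x, (i, j))` be the coefficient `(ξⱼ, ξᵢ)` at `x`. On a fibre of `G × I₂`, the kernel `F (q⁻¹ p)` is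
then the Gram kernel of the vectors `L x (ξⱼ (s x))`, where `p = (x, (i, j))`. Hence the double
integral in the definition of positivity is the squared norm of a vector-valued integral
(`integral_integral_nonneg_of_gram`).

Conversely, testing a positive definite `F` on combinations of bump functions shows that `F (q⁻¹ p)`
is a positive semidefinite kernel on each fibre (`sum_nonneg`). The GNS construction yields Hilbert
spaces spanned by vectors `e p`, with left translation acting unitarily. The integrals `∫ f e`
against `f ∈ C_c` generate a continuous field, because fibre integrals of jointly continuous kernels
vary continuously (`continuous_integral_mul`). Restrict this field to the units `(a, 0)` and let `G`
act through `x ↦ (x, (0, 0))`. Each fibre still contains both `e (unit a, (0, 0))` and `e (unit a,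
(0, 1))`; these are bounded continuous sections, and the coefficient of the second against the first
is `F (x, (0, 1)) = φ x`. -/

namespace TopologicalGroupoid

/-! ### Groupoid identities. -/

section Algebra

variable {X : Type u} {G : Type v} [TopologicalSpace X] [TopologicalSpace G]

theorem t2Space_units [T2Space G] (𝒢 : TopologicalGroupoid X G) : T2Space X :=
  T2Space.of_injective_continuous (Function.LeftInverse.injective 𝒢.r_unit) 𝒢.continuous_unit

theorem inv_mul_cancel_left (𝒢 : TopologicalGroupoid X G) {x z : G} (h : 𝒢.s x = 𝒢.r z) :
    𝒢.mul (𝒢.inv x) (𝒢.mul x z) = z := by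
  rw [← 𝒢.mul_assoc _ _ _ (𝒢.s_inv x) h, 𝒢.inv_mul, h, 𝒢.unit_mul]

theorem mul_inv_cancel_left (𝒢 : TopologicalGroupoid X G) {x z : G} (h : 𝒢.r x = 𝒢.r z) :
    𝒢.mul x (𝒢.mul (𝒢.inv x) z) = z := by
  rw [← 𝒢.mul_assoc _ _ _ (𝒢.r_inv x).symm ((𝒢.s_inv x).trans h), 𝒢.mul_inv, h, 𝒢.unit_mul]

theorem inv_mul_mul (𝒢 : TopologicalGroupoid X G) {z y : G} (h : 𝒢.s z = 𝒢.r y) :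
    𝒢.mul (𝒢.inv (𝒢.mul z y)) z = 𝒢.inv y := by
  have h1 : 𝒢.s (𝒢.inv (𝒢.mul z y)) = 𝒢.r z := (𝒢.s_inv _).trans (𝒢.r_mul z y h)
  have h2 : 𝒢.s (𝒢.mul (𝒢.inv (𝒢.mul z y)) z) = 𝒢.r y := (𝒢.s_mul _ _ h1).trans h
  calc 𝒢.mul (𝒢.inv (𝒢.mul z y)) z
      = 𝒢.mul (𝒢.mul (𝒢.inv (𝒢.mul z y)) z) (𝒢.mul y (𝒢.inv y)) := by
        rw [𝒢.mul_inv, ← h2, 𝒢.mul_unit]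
    _ = 𝒢.mul (𝒢.mul (𝒢.inv (𝒢.mul z y)) (𝒢.mul z y)) (𝒢.inv y) := by
        rw [← 𝒢.mul_assoc _ _ _ h2 (𝒢.r_inv y).symm, 𝒢.mul_assoc _ z y h1 h]
    _ = 𝒢.inv y := by
        rw [𝒢.inv_mul, 𝒢.s_mul z y h, ← 𝒢.r_inv, 𝒢.unit_mul]

/-- Invariance of the kernel `φ (y⁻¹ x)` under left translation; this is what makes translations
isometric on the GNS spaces. -/
theorem inv_mul_mul_mul (𝒢 : TopologicalGroupoid X G) {z y x : G} (hy : 𝒢.s z = 𝒢.r y)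
    (hx : 𝒢.s z = 𝒢.r x) :
    𝒢.mul (𝒢.inv (𝒢.mul z y)) (𝒢.mul z x) = 𝒢.mul (𝒢.inv y) x := by
  rw [← 𝒢.mul_assoc _ _ _ ((𝒢.s_inv _).trans (𝒢.r_mul z y hy)) hx, 𝒢.inv_mul_mul hy]

theorem unit_mul_unit (𝒢 : TopologicalGroupoid X G) (a : X) :
    𝒢.mul (𝒢.unit a) (𝒢.unit a) = 𝒢.unit a := by
  simpa [𝒢.r_unit] using 𝒢.unit_mul (𝒢.unit a)

theorem inv_unit (𝒢 : TopologicalGroupoid X G) (a : X) : 𝒢.inv (𝒢.unit a) = 𝒢.unit a := by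
  have h := 𝒢.inv_mul (𝒢.unit a)
  rw [𝒢.s_unit] at h
  have h2 := 𝒢.mul_unit (𝒢.inv (𝒢.unit a))
  rw [𝒢.s_inv, 𝒢.r_unit] at h2
  rw [← h2, h]

theorem continuousOn_inv_mul (𝒢 : TopologicalGroupoid X G) :
    ContinuousOn (fun p : G × G => 𝒢.mul (𝒢.inv p.1) p.2) {p | 𝒢.r p.1 = 𝒢.r p.2} :=
  𝒢.continuousOn_mul.comp (f := fun p : G × G => (𝒢.inv p.1, p.2))
    ((𝒢.continuous_inv.comp continuous_fst).prodMk continuous_snd).continuousOn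
    fun p hp => (𝒢.s_inv p.1).trans hp

end Algebra

/-! ### Integration along the fibres of the range map. -/

section Integration

variable {X : Type u} {G : Type v} [TopologicalSpace X] [TopologicalSpace G]
    [LocallyCompactSpace G] [T2Space G] [SecondCountableTopology G]
    [MeasurableSpace G] [BorelSpace G]
    {𝒢 : TopologicalGroupoid X G} {haar : X → Measure G}

theorem IsHaarSystem.restrict_fiber (h : 𝒢.IsHaarSystem haar) (a : X) :
    (haar a).restrict {x | 𝒢.r x = a} = haar a :=
  Measure.restrict_eq_self_of_ae_mem (h.ae_fiber a)

/-- The measure `haar a` lives on a closed fibre, so continuity is needed only there. This matters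
because the product is controlled only on composable pairs. -/
theorem IsHaarSystem.integrable_of_continuousOn (h : 𝒢.IsHaarSystem haar) {E : Type*}
    [NormedAddCommGroup E] {a : X} {f : G → E} (hf : ContinuousOn f {x | 𝒢.r x = a})
    {K : Set G} (hK : IsCompact K) (hz : ∀ x, 𝒢.r x = a → x ∉ K → f x = 0) :
    Integrable f (haar a) := by
  have := h.finiteOnCompacts a
  have hS := 𝒢.isClosed_fiber a
  have hon : IntegrableOn f ({x | 𝒢.r x = a} ∩ K) (haar a) :=
    ContinuousOn.integrableOn_compact (hK.inter_left hS) (hf.mono Set.inter_subset_left)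
  have hon' : IntegrableOn f {x | 𝒢.r x = a} (haar a) :=
    hon.of_forall_sdiff_eq_zero hS.measurableSet fun z hz' => hz z hz'.1 fun hk => hz'.2 ⟨hz'.1, hk⟩
  rwa [IntegrableOn, h.restrict_fiber] at hon'

theorem IsHaarSystem.integrable_smul (h : 𝒢.IsHaarSystem haar) {E : Type*}
    [NormedAddCommGroup E] {𝕜 : Type*} [NontriviallyNormedField 𝕜] [NormedSpace 𝕜 E] {a : X}
    {f : G → 𝕜} (hf : Continuous f)
    (hc : HasCompactSupport f) {k : G → E} (hk : ContinuousOn k {x | 𝒢.r x = a}) :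
    Integrable (fun x => f x • k x) (haar a) :=
  h.integrable_of_continuousOn (hf.continuousOn.smul hk) hc.isCompact
    fun x _ hx => by rw [image_eq_zero_of_notMem_tsupport hx, zero_smul]

/-- The support of `haar a` is the whole fibre, so a Urysohn function at `x₀` has positive integral
and can be normalised. These functions serve as approximate point masses. -/
theorem IsHaarSystem.exists_bump (h : 𝒢.IsHaarSystem haar) {a : X} {x₀ : G} (hx : 𝒢.r x₀ = a)
    {U : Set G} (hU : U ∈ 𝓝 x₀) :
    ∃ g : G → ℝ, Continuous g ∧ HasCompactSupport g ∧ (∀ x, 0 ≤ g x) ∧ (∀ x, x ∉ U → g x = 0) ∧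
      ∫ x, g x ∂(haar a) = 1 := by
  have := h.finiteOnCompacts a
  obtain ⟨f, hf1, hf0, hfc, hfr⟩ := exists_continuous_one_zero_of_isCompact
    (isCompact_singleton (x := x₀)) (t := (interior U)ᶜ) isOpen_interior.isClosed_compl
    (by simpa [mem_interior_iff_mem_nhds] using hU)
  have hi : Integrable f (haar a) := f.continuous.integrable_of_hasCompactSupport hfc
  have hpos : 0 < ∫ x, f x ∂(haar a) := by
    rw [integral_pos_iff_support_of_nonneg (fun x => (hfr x).1) hi]
    have hmem : x₀ ∈ (haar a).support := by rw [h.support_eq]; exact hx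
    rw [Measure.mem_support_iff_forall] at hmem
    refine hmem _ ((f.continuous.isOpen_support).mem_nhds ?_)
    simp [hf1 (Set.mem_singleton x₀)]
  refine ⟨fun x => (∫ x, f x ∂(haar a))⁻¹ * f x, by fun_prop, hfc.mul_left, fun x =>
    mul_nonneg (inv_nonneg.2 hpos.le) (hfr x).1, fun x hx => ?_, ?_⟩
  · change _ * f x = 0
    rw [hf0 (fun hx' => hx (interior_subset hx')), Pi.zero_apply, mul_zero]
  · rw [integral_const_mul, inv_mul_cancel₀ hpos.ne']

/-- Integrals along the fibres of a compactly supported function, weighted by a function that is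
jointly continuous on the fibred product, depend continuously on the parameter. -/
theorem IsHaarSystem.continuous_integral_mul (h : 𝒢.IsHaarSystem haar) {Z : Type*}
    [TopologicalSpace Z] {p : Z → X} (hp : Continuous p) {k : Z × G → ℂ}
    (hk : ContinuousOn k {q | 𝒢.r q.2 = p q.1}) {f : G → ℂ} (hf : Continuous f)
    (hc : HasCompactSupport f) :
    Continuous fun z => ∫ x, f x * k (z, x) ∂(haar (p z)) := by
  have : T2Space X := 𝒢.t2Space_units
  have hkz : ∀ z, ContinuousOn (fun x => k (z, x)) {x | 𝒢.r x = p z} := fun z =>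
    hk.comp (f := fun x => (z, x)) (by fun_prop) fun x hx => hx
  have hik : ∀ z, Integrable (fun x => f x * k (z, x)) (haar (p z)) := fun z =>
    h.integrable_smul hf hc (hkz z)
  rw [continuous_iff_continuousAt]
  intro z₀
  -- Tietze: extend `k (z₀, ·)` from the closed fibre to all of `G`. The axiom of a Haar system then
  -- applies to `f * k₀`, and only the error `k (z, ·) - k₀` has to be controlled.
  obtain ⟨k₀, hk₀⟩ := ContinuousMap.exists_restrict_eq (𝒢.isClosed_fiber (p z₀))
    (⟨_, (hkz z₀).domRestrict⟩ : C({x | 𝒢.r x = p z₀}, ℂ))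
  have hk₀' : ∀ x, 𝒢.r x = p z₀ → k₀ x = k (z₀, x) := fun x hx =>
    congrArg (fun g : C({x | 𝒢.r x = p z₀}, ℂ) => g ⟨x, hx⟩) hk₀
  have hi₀ : ∀ z, Integrable (fun x => f x * k₀ x) (haar (p z)) := fun z =>
    h.integrable_smul hf hc k₀.continuous.continuousOn
  have hc₀ : Continuous fun z => ∫ x, f x * k₀ x ∂(haar (p z)) :=
    (h.continuous_integral (fun x => f x * k₀ x) (by fun_prop) hc.mul_right).comp hp
  set M : Z → ℝ := fun z => ‖∫ x, ((‖f x‖ : ℝ) : ℂ) ∂(haar (p z))‖ with hM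
  have hMc : Continuous M := ((h.continuous_integral (fun x => ((‖f x‖ : ℝ) : ℂ)) (by fun_prop)
    (hc.norm.comp_left (g := fun t : ℝ => (t : ℂ)) (by simp))).comp hp).norm
  have hMz : ∀ z, M z = ∫ x, ‖f x‖ ∂(haar (p z)) := by
    intro z
    rw [hM]
    beta_reduce
    rw [integral_complex_ofReal, Complex.norm_real, Real.norm_eq_abs,
      abs_of_nonneg (integral_nonneg fun x => norm_nonneg _)]
  -- Uniformity comes from compactness of `tsupport f`. At a point of the support off the fibre over
  -- `p z₀`, the unit space being Hausdorff makes the condition vacuous nearby.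
  have hclose : ∀ ε > 0, ∀ᶠ z in 𝓝 z₀, ∀ x ∈ tsupport f, 𝒢.r x = p z →
      ‖k (z, x) - k₀ x‖ < ε := by
    intro ε hε
    have key := hc.isCompact.eventually_forall_of_forall_eventually (x₀ := z₀)
      (P := fun z x => 𝒢.r x = p z → ‖k (z, x) - k₀ x‖ < ε) ?_
    · exact key
    · intro x hx
      by_cases hr : 𝒢.r x = p z₀
      · have hcont : ContinuousWithinAt (fun q : Z × G => ‖k q - k₀ q.2‖)
            {q | 𝒢.r q.2 = p q.1} (z₀, x) :=
          ((hk (z₀, x) hr).sub (by fun_prop)).norm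
        have := hcont.eventually_lt_const (u := ε) (by simpa [hk₀' x hr] using hε)
        exact eventually_nhdsWithin_iff.1 this
      · have : ∀ᶠ q : Z × G in 𝓝 (z₀, x), 𝒢.r q.2 ≠ p q.1 :=
          (isOpen_ne_fun (𝒢.continuous_r.comp continuous_snd)
            (hp.comp continuous_fst)).mem_nhds hr
        exact this.mono fun q hq hq' => absurd hq' hq
  rw [ContinuousAt, Metric.tendsto_nhds]
  intro ε hε
  set δ : ℝ := ε / (2 * (M z₀ + 1)) with hδ
  have hM0 : 0 ≤ M z₀ := norm_nonneg _
  have hδ0 : 0 < δ := by positivity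
  filter_upwards [hclose δ hδ0, hMc.continuousAt.eventually (gt_mem_nhds (lt_add_one (M z₀))),
    Metric.tendsto_nhds.1 hc₀.continuousAt (ε / 2) (by positivity)] with z hz hzM hzc
  have e0 : ∫ x, f x * k (z₀, x) ∂(haar (p z₀)) = ∫ x, f x * k₀ x ∂(haar (p z₀)) := by
    refine integral_congr_ae ?_
    filter_upwards [h.ae_fiber (p z₀)] with x hx
    rw [hk₀' x hx]
  have e1 : ‖∫ x, f x * k (z, x) ∂(haar (p z)) - ∫ x, f x * k₀ x ∂(haar (p z))‖ ≤ δ * M z := by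
    rw [← integral_sub (hik z) (hi₀ z), hMz, ← integral_const_mul]
    refine norm_integral_le_of_norm_le ?_ ?_
    · have := h.finiteOnCompacts (p z)
      exact (hf.norm.integrable_of_hasCompactSupport hc.norm).const_mul δ
    · filter_upwards [h.ae_fiber (p z)] with x hx
      rw [← mul_sub, norm_mul, mul_comm δ]
      by_cases hxs : x ∈ tsupport f
      · exact mul_le_mul_of_nonneg_left (hz x hxs hx).le (norm_nonneg _)
      · simp [image_eq_zero_of_notMem_tsupport hxs]
  rw [e0, dist_eq_norm]
  rw [dist_eq_norm] at hzc
  have e2 : δ * M z ≤ ε / 2 := by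
    calc δ * M z ≤ δ * (M z₀ + 1) := mul_le_mul_of_nonneg_left hzM.le hδ0.le
      _ = ε / 2 := by rw [hδ]; field_simp
  calc _ ≤ ‖∫ x, f x * k (z, x) ∂(haar (p z)) - ∫ x, f x * k₀ x ∂(haar (p z))‖ +
        ‖∫ x, f x * k₀ x ∂(haar (p z)) - ∫ x, f x * k₀ x ∂(haar (p z₀))‖ :=
        norm_sub_le_norm_sub_add_norm_sub _ _ _
    _ < ε := by linarith

end Integration

end TopologicalGroupoid

namespace TopologicalGroupoid

/-! ### Positive definite functions and positive semidefinite kernels. -/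

section PositiveDefinite

variable {X : Type u} {G : Type v} [TopologicalSpace X] [TopologicalSpace G]

/-- A Hilbert space valued map on a fibre whose Gram kernel is `φ (y⁻¹ x)` is continuous if `φ`
is. -/
theorem continuousOn_of_gram (𝒢 : TopologicalGroupoid X G) {φ : G → ℂ} (hφ : Continuous φ)
    {H : Type*} [NormedAddCommGroup H] [InnerProductSpace ℂ H] {a : X} {e : G → H}
    (he : ∀ x y, 𝒢.r x = a → 𝒢.r y = a → inner ℂ (e x) (e y) = φ (𝒢.mul (𝒢.inv y) x)) :
    ContinuousOn e {x | 𝒢.r x = a} := by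
  intro x₀ hx₀
  have hK : ContinuousOn (fun p : G × G => φ (𝒢.mul (𝒢.inv p.1) p.2)) {p | 𝒢.r p.1 = 𝒢.r p.2} :=
    hφ.comp_continuousOn 𝒢.continuousOn_inv_mul
  -- This is `‖e x - e x₀‖ ^ 2` expanded: each term is a value of `φ` at a product continuous in
  -- `x`, and the sum vanishes at `x₀`.
  have hc : ContinuousOn (fun x => (inner ℂ (e x) (e x) - inner ℂ (e x₀) (e x)
      - inner ℂ (e x) (e x₀) + inner ℂ (e x₀) (e x₀) : ℂ)) {x | 𝒢.r x = a} := by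
    have h1 : ContinuousOn (fun x => (inner ℂ (e x) (e x) : ℂ)) {x | 𝒢.r x = a} :=
      (hK.comp (f := fun x => (x, x)) (by fun_prop) fun x _ => rfl).congr fun x hx => he x x hx hx
    have h2 : ContinuousOn (fun x => (inner ℂ (e x₀) (e x) : ℂ)) {x | 𝒢.r x = a} :=
      (hK.comp (f := fun x => (x, x₀)) (by fun_prop) fun x hx => Eq.trans hx hx₀.symm).congr
        fun x hx => he x₀ x hx₀ hx
    have h3 : ContinuousOn (fun x => (inner ℂ (e x) (e x₀) : ℂ)) {x | 𝒢.r x = a} :=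
      (hK.comp (f := fun x => (x₀, x)) (by fun_prop) fun x hx => Eq.trans hx₀ (Eq.symm hx)).congr
        fun x hx => he x x₀ hx hx₀
    exact ((h1.sub h2).sub h3).add continuousOn_const
  have hs : ∀ x, ‖e x - e x₀‖ ^ 2 = (inner ℂ (e x) (e x) - inner ℂ (e x₀) (e x)
      - inner ℂ (e x) (e x₀) + inner ℂ (e x₀) (e x₀) : ℂ).re := by
    intro x
    have h1 : inner ℂ (e x - e x₀) (e x - e x₀) = (inner ℂ (e x) (e x) - inner ℂ (e x₀) (e x)
      - inner ℂ (e x) (e x₀) + inner ℂ (e x₀) (e x₀) : ℂ) := by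
      rw [inner_sub_left, inner_sub_right, inner_sub_right]; ring
    rw [← h1]
    exact (inner_self_eq_norm_sq (𝕜 := ℂ) _).symm
  have ht := (Complex.continuous_re.comp_continuousOn hc x₀ hx₀).tendsto
  simp only [Function.comp_def, ← hs, sub_self] at ht
  rw [ContinuousWithinAt, tendsto_iff_norm_sub_tendsto_zero]
  simpa using ht.sqrt

variable [LocallyCompactSpace G] [T2Space G] [SecondCountableTopology G]
    [MeasurableSpace G] [BorelSpace G]
    {𝒢 : TopologicalGroupoid X G} {haar : X → Measure G}

/-- The double integral equals `‖w‖ ^ 2` for `w = ∫ f(x) e(x)`: pull both integrals into the inner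
product. -/
theorem IsHaarSystem.integral_integral_nonneg_of_gram (h : 𝒢.IsHaarSystem haar) {φ : G → ℂ}
    (hφ : Continuous φ) {H : Type*} [NormedAddCommGroup H] [InnerProductSpace ℂ H]
    [CompleteSpace H] {a : X} {e : G → H}
    (he : ∀ x y, 𝒢.r x = a → 𝒢.r y = a → inner ℂ (e x) (e y) = φ (𝒢.mul (𝒢.inv y) x))
    {f : G → ℂ} (hf : Continuous f) (hc : HasCompactSupport f) :
    0 ≤ ∫ y, ∫ x, φ (𝒢.mul (𝒢.inv y) x) * f y * conj (f x) ∂(haar a) ∂(haar a) := by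
  have hi : Integrable (fun x => f x • e x) (haar a) :=
    h.integrable_smul hf hc (𝒢.continuousOn_of_gram hφ he)
  set w : H := ∫ x, f x • e x ∂(haar a) with hw
  have hin : ∀ y, 𝒢.r y = a →
      ∫ x, φ (𝒢.mul (𝒢.inv y) x) * f y * conj (f x) ∂(haar a) = inner ℂ w (f y • e y) := by
    intro y hy
    rw [← inner_conj_symm, hw, ← integral_inner hi, ← integral_conj]
    refine integral_congr_ae ?_
    filter_upwards [h.ae_fiber a] with x hx
    rw [inner_conj_symm, inner_smul_left, inner_smul_right, he x y hx hy]
    ring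
  have : ∫ y, ∫ x, φ (𝒢.mul (𝒢.inv y) x) * f y * conj (f x) ∂(haar a) ∂(haar a)
      = inner ℂ w w := by
    conv_rhs => rw [hw, ← integral_inner hi, ← hw]
    refine integral_congr_ae ?_
    filter_upwards [h.ae_fiber a] with y hy
    exact hin y hy
  rw [this, inner_self_eq_norm_sq_to_K, ← RCLike.ofReal_pow]
  exact Complex.zero_le_real.2 (sq_nonneg ‖w‖)

theorem IsHaarSystem.norm_integral_smul_sub_le (h : 𝒢.IsHaarSystem haar) {E : Type*}
    [NormedAddCommGroup E] [NormedSpace ℝ E] [CompleteSpace E] {a : X} {g : G → ℝ}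
    (hg : Continuous g) (hc : HasCompactSupport g) (h0 : ∀ x, 0 ≤ g x)
    (h1 : ∫ x, g x ∂(haar a) = 1) {k : G → E} (hk : ContinuousOn k {x | 𝒢.r x = a}) {e : E}
    {δ : ℝ} (hδ : ∀ x, 𝒢.r x = a → g x ≠ 0 → ‖k x - e‖ ≤ δ) :
    ‖∫ x, g x • k x ∂(haar a) - e‖ ≤ δ := by
  have := h.finiteOnCompacts a
  have hgi : Integrable g (haar a) := hg.integrable_of_hasCompactSupport hc
  have he : e = ∫ x, g x • e ∂(haar a) := by rw [integral_smul_const, h1, one_smul]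
  calc ‖∫ x, g x • k x ∂(haar a) - e‖ = ‖∫ x, g x • (k x - e) ∂(haar a)‖ := by
        conv_lhs => rw [he]
        rw [← integral_sub (h.integrable_smul hg hc hk) (hgi.smul_const e)]
        simp only [smul_sub]
    _ ≤ ∫ x, g x * δ ∂(haar a) := by
        refine norm_integral_le_of_norm_le (hgi.mul_const δ) ?_
        filter_upwards [h.ae_fiber a] with x hx
        rw [norm_smul, Real.norm_of_nonneg (h0 x)]
        by_cases hgx : g x = 0
        · simp [hgx]
        · exact mul_le_mul_of_nonneg_left (hδ x hx hgx) (h0 x)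
    _ = δ := by rw [integral_mul_const, h1, one_mul]

/-- Replace the point mass at each `x j` by a normalised bump `g j` and test positivity on `f = ∑ c
j * g j`. As the bumps shrink, the double integrals approach the finite sum, and the nonnegative
numbers are closed in `ℂ`. -/
theorem IsPositiveDefinite.sum_nonneg {φ : G → ℂ} (hφ : 𝒢.IsPositiveDefinite haar φ)
    (h : 𝒢.IsHaarSystem haar) {a : X} {ι : Type*} (s : Finset ι) {x : ι → G}
    (hx : ∀ i, 𝒢.r (x i) = a) (c : ι → ℂ) :
    0 ≤ ∑ i ∈ s, ∑ j ∈ s, conj (c i) * c j * φ (𝒢.mul (𝒢.inv (x j)) (x i)) := by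
  obtain ⟨hcont, -, hpos⟩ := hφ
  have hK : ContinuousOn (fun p : G × G => φ (𝒢.mul (𝒢.inv p.1) p.2)) {p | 𝒢.r p.1 = 𝒢.r p.2} :=
    hcont.comp_continuousOn 𝒢.continuousOn_inv_mul
  set S : ℂ := ∑ i ∈ s, ∑ j ∈ s, conj (c i) * c j * φ (𝒢.mul (𝒢.inv (x j)) (x i)) with hS
  suffices hap : ∀ ε > 0, ∃ z : ℂ, 0 ≤ z ∧ ‖z - S‖ < ε by
    have hcl : S ∈ closure {z : ℂ | 0 ≤ z} := by
      rw [Metric.mem_closure_iff]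
      intro ε hε
      obtain ⟨z, hz, hzS⟩ := hap ε hε
      exact ⟨z, hz, by rwa [dist_comm, dist_eq_norm]⟩
    have hclosed : IsClosed {z : ℂ | 0 ≤ z} := by
      simp only [Complex.le_def, Complex.zero_re, Complex.zero_im]
      exact (isClosed_le continuous_const Complex.continuous_re).inter
        (isClosed_eq continuous_const Complex.continuous_im)
    rwa [hclosed.closure_eq] at hcl
  intro ε hε
  set A : ℝ := ∑ i ∈ s, ∑ j ∈ s, ‖c i‖ * ‖c j‖ with hA
  have hA0 : 0 ≤ A := Finset.sum_nonneg fun i _ => Finset.sum_nonneg fun j _ => by positivity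
  set δ : ℝ := ε / (A + 1) with hδ
  have hδ0 : 0 < δ := by positivity
  have hnb : ∀ i j, ∃ V ∈ 𝓝 (x j), ∃ U ∈ 𝓝 (x i), ∀ y ∈ V, ∀ z ∈ U, 𝒢.r y = a → 𝒢.r z = a →
      ‖φ (𝒢.mul (𝒢.inv y) z) - φ (𝒢.mul (𝒢.inv (x j)) (x i))‖ ≤ δ := by
    intro i j
    have := (hK (x j, x i) ((hx j).trans (hx i).symm))
    have := Metric.tendsto_nhds.1 this δ hδ0
    rw [eventually_nhdsWithin_iff, nhds_prod_eq, Filter.eventually_prod_iff] at this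
    obtain ⟨p, hp, q, hq, hpq⟩ := this
    refine ⟨{y | p y}, hp, {z | q z}, hq, fun y hy z hz hya hza => ?_⟩
    have := hpq hy hz (hya.trans hza.symm)
    rw [dist_eq_norm] at this
    exact this.le
  choose V hV U hU hVU using hnb
  -- The point `x i` occurs both as left and as right argument of the kernel, so its bump must fit
  -- both families of neighbourhoods.
  have hW : ∀ i, (⋂ j ∈ s, U i j ∩ V j i) ∈ 𝓝 (x i) := fun i =>
    (Filter.biInter_finset_mem s).2 fun j _ => Filter.inter_mem (hU i j) (hV j i)
  choose g hg hgc hg0 hgW hg1 using fun i => h.exists_bump (hx i) (hW i)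
  have hgU : ∀ i, ∀ j ∈ s, ∀ z, g i z ≠ 0 → z ∈ U i j ∩ V j i := by
    intro i j hj z hz
    by_contra hzn
    exact hz (hgW i z fun hzW => hzn (Set.mem_iInter₂.1 hzW j hj))
  -- The kernel averaged in its right argument against the bump at `x i`. Averaging `B i` against `g
  -- j` then gives the `(i, j)` term of the double integral, up to its coefficient.
  set B : ι → G → ℂ := fun i y => ∫ z, g i z • φ (𝒢.mul (𝒢.inv y) z) ∂(haar a) with hB
  have hKy : ∀ y, 𝒢.r y = a →
      ContinuousOn (fun z => φ (𝒢.mul (𝒢.inv y) z)) {z | 𝒢.r z = a} := fun y hy =>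
    hK.comp (f := fun z => (y, z)) (by fun_prop) fun z hz => Eq.trans hy (Eq.symm hz)
  have hBc : ∀ i, ContinuousOn (B i) {y | 𝒢.r y = a} := by
    intro i
    rw [continuousOn_iff_continuous_domRestrict]
    have := h.continuous_integral_mul (Z := {y | 𝒢.r y = a}) (p := fun _ => a) continuous_const
      (k := fun q => φ (𝒢.mul (𝒢.inv q.1) q.2))
      (hK.comp (f := fun q : {y | 𝒢.r y = a} × G => ((q.1 : G), q.2)) (by fun_prop)
        fun q hq => Eq.trans q.1.2 (Eq.symm hq))
      (f := fun z => (g i z : ℂ)) (Complex.continuous_ofReal.comp (hg i))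
      ((hgc i).comp_left (g := fun t : ℝ => (t : ℂ)) Complex.ofReal_zero)
    simp only [← Complex.real_smul] at this
    exact this
  have hBapp : ∀ i ∈ s, ∀ j ∈ s, ‖∫ y, g j y • B i y ∂(haar a)
      - φ (𝒢.mul (𝒢.inv (x j)) (x i))‖ ≤ δ := fun i hi j hj =>
    h.norm_integral_smul_sub_le (hg j) (hgc j) (hg0 j) (hg1 j) (hBc i) fun y hy hgy =>
      h.norm_integral_smul_sub_le (hg i) (hgc i) (hg0 i) (hg1 i) (hKy y hy) fun z hz hgz =>
        hVU i j y (hgU j i hi y hgy).2 z (hgU i j hj z hgz).1 hy hz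
  set f : G → ℂ := fun y => ∑ j ∈ s, c j * g j y with hf
  have hfc : Continuous f := by
    have := fun j => hg j
    fun_prop
  have hfs : HasCompactSupport f := by
    refine HasCompactSupport.intro (s.isCompact_biUnion fun j _ => (hgc j).isCompact) ?_
    intro y hy
    refine Finset.sum_eq_zero fun j hj => ?_
    rw [image_eq_zero_of_notMem_tsupport fun hyj => hy (Set.mem_biUnion hj hyj)]
    simp
  refine ⟨_, hpos a f hfc hfs, ?_⟩
  have hinner : ∀ y, 𝒢.r y = a → ∫ z, φ (𝒢.mul (𝒢.inv y) z) * f y * conj (f z) ∂(haar a)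
      = ∑ i ∈ s, ∑ j ∈ s, (conj (c i) * c j) * (g j y • B i y) := by
    intro y hy
    have : ∀ z, φ (𝒢.mul (𝒢.inv y) z) * f y * conj (f z) =
        ∑ i ∈ s, (f y * conj (c i)) * (g i z • φ (𝒢.mul (𝒢.inv y) z)) := by
      intro z
      have hz : conj (f z) = ∑ i ∈ s, conj (c i) * g i z := by
        simp only [hf, map_sum, map_mul, Complex.conj_ofReal]
      simp only [hz, Finset.mul_sum, Complex.real_smul]
      exact Finset.sum_congr rfl fun i _ => by ring
    simp only [this]
    rw [integral_finsetSum _ fun i _ => (h.integrable_smul (hg i) (hgc i) (hKy y hy)).const_mul _]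
    refine Finset.sum_congr rfl fun i _ => ?_
    rw [integral_const_mul]
    change f y * conj (c i) * B i y = _
    simp only [hf, Finset.sum_mul, Complex.real_smul]
    exact Finset.sum_congr rfl fun i _ => by ring
  have hgB : ∀ i j, Integrable (fun y => (conj (c i) * c j) * (g j y • B i y)) (haar a) :=
    fun i j => (h.integrable_smul (hg j) (hgc j) (hBc i)).const_mul _
  have hQ : ∫ y, ∫ z, φ (𝒢.mul (𝒢.inv y) z) * f y * conj (f z) ∂(haar a) ∂(haar a)
      = ∑ i ∈ s, ∑ j ∈ s, (conj (c i) * c j) * ∫ y, g j y • B i y ∂(haar a) := by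
    rw [integral_congr_ae ((h.ae_fiber a).mono hinner),
      integral_finsetSum _ fun i _ => integrable_finsetSum _ fun j _ => hgB i j]
    refine Finset.sum_congr rfl fun i _ => ?_
    rw [integral_finsetSum _ fun j _ => hgB i j]
    exact Finset.sum_congr rfl fun j _ => integral_const_mul _ _
  rw [hQ, hS, ← Finset.sum_sub_distrib]
  calc _ ≤ ∑ i ∈ s, ∑ j ∈ s, ‖c i‖ * ‖c j‖ * δ := by
        refine (norm_sum_le _ _).trans (Finset.sum_le_sum fun i hi => ?_)
        rw [← Finset.sum_sub_distrib]
        refine (norm_sum_le _ _).trans (Finset.sum_le_sum fun j hj => ?_)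
        rw [← mul_sub, norm_mul, norm_mul, Complex.norm_conj]
        exact mul_le_mul_of_nonneg_left (hBapp i hi j hj) (by positivity)
    _ = A * δ := by simp only [hA, Finset.sum_mul]
    _ < ε := by
        rw [hδ, mul_div_assoc', div_lt_iff₀ (by positivity)]
        nlinarith

end PositiveDefinite

end TopologicalGroupoid

/-! ### Hilbert spaces from kernels. -/

/-- The Gelfand-Naimark-Segal construction for a positive semidefinite kernel. -/
theorem exists_inner_eq_kernel {S : Type v} (K : S → S → ℂ)
    (hK : ∀ (n : Type v) (s : Finset n) (x : n → S) (c : n → ℂ),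
      0 ≤ ∑ i ∈ s, ∑ j ∈ s, conj (c i) * c j * K (x i) (x j)) :
    ∃ (H : Type v) (_ : NormedAddCommGroup H) (_ : InnerProductSpace ℂ H) (_ : CompleteSpace H)
      (e : S → H), (∀ x y, inner ℂ (e x) (e y) = K x y) ∧
        (Submodule.span ℂ (Set.range e)).topologicalClosure = ⊤ := by
  -- Positivity forces Hermitian symmetry: one-point sums make the diagonal real, and two-point sums
  -- with coefficients `1, t` for `t = 1, I` compare the real and imaginary parts off it.
  have hherm : ∀ x y, conj (K y x) = K x y := by
    intro x y
    have hd : ∀ x, (K x x).im = 0 := by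
      intro x
      have := hK PUnit Finset.univ (fun _ => x) (fun _ => 1)
      simpa using (Complex.le_def.1 this).2.symm
    have key : ∀ t : ℂ, (t * K x y + conj t * K y x).im = 0 := by
      intro t
      have := hK (ULift (Fin 2)) Finset.univ (fun i => ![x, y] i.down) (fun i => ![1, t] i.down)
      have h2 := (Complex.le_def.1 this).2.symm
      rw [← Equiv.sum_comp Equiv.ulift.symm] at h2
      simp only [← Equiv.sum_comp (Equiv.ulift (α := Fin 2)).symm, Fin.sum_univ_two] at h2
      simp [hd] at h2
      simp
      linarith
    have h1 := key 1
    have h2 := key Complex.I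
    simp at h1 h2
    apply Complex.ext
    · simp; linarith
    · simp; linarith
  -- The scalar kernel is viewed as operator-valued on `ℂ`; the required vectors are the kernel
  -- functions applied to `1`.
  set M : Matrix S S (ℂ →L[ℂ] ℂ) := .of fun x y => K x y • ContinuousLinearMap.id ℂ ℂ with hM
  have hMh : M.IsHermitian := by
    ext x y
    have : star (ContinuousLinearMap.id ℂ ℂ) = ContinuousLinearMap.id ℂ ℂ :=
      star_one (ℂ →L[ℂ] ℂ)
    simp [hM, Matrix.conjTranspose_apply, ← hherm x y, this]
  have hMp : M.PosSemidef := by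
    refine ((RKHS.posSemidef_tfae (K := M)).out 0 2).2 (And.intro hMh fun c => ?_)
    have h0 := hK S c.support id c
    have := (Complex.le_def.1 h0).1
    simp only [Finsupp.sum, hM]
    convert! this using 2
    refine Finset.sum_congr rfl fun x _ => Finset.sum_congr rfl fun y _ => ?_
    simp [hherm]
    ring
  have : Fact M.PosSemidef := ⟨hMp⟩
  refine ⟨RKHS.OfKernel M, inferInstance, inferInstance, inferInstance,
    fun x => RKHS.kerFun (RKHS.OfKernel M) x 1, fun x y => ?_, ?_⟩
  · rw [← RKHS.kernel_inner, RKHS.OfKernel.kernel_ofKernel]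
    simp [hM, hherm]
  · rw [eq_top_iff, ← RKHS.kerFun_dense (RKHS.OfKernel M)]
    refine Submodule.topologicalClosure_mono (Submodule.span_le.2 ?_)
    rintro _ ⟨x, t, rfl⟩
    have : RKHS.kerFun (RKHS.OfKernel M) x t = t • RKHS.kerFun (RKHS.OfKernel M) x 1 := by
      rw [← map_smul, smul_eq_mul, mul_one]
    rw [this]
    exact Submodule.smul_mem _ _ (Submodule.subset_span ⟨x, rfl⟩)

theorem denseRange_linearCombination {S H : Type*} [NormedAddCommGroup H] [InnerProductSpace ℂ H]
    {e : S → H} (he : (Submodule.span ℂ (Set.range e)).topologicalClosure = ⊤) :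
    DenseRange (Finsupp.linearCombination ℂ e) := by
  rw [DenseRange, ← LinearMap.coe_range, Finsupp.range_linearCombination]
  exact Submodule.dense_iff_topologicalClosure_eq_top.2 he

/-- Families with dense spans and the same Gram kernel are unitarily equivalent. -/
theorem exists_linearIsometryEquiv_of_inner_eq {S T H H' : Type*} [NormedAddCommGroup H]
    [InnerProductSpace ℂ H] [CompleteSpace H] [NormedAddCommGroup H'] [InnerProductSpace ℂ H']
    [CompleteSpace H'] {e : S → H} {e' : T → H'} (σ : S ≃ T)
    (hin : ∀ x y, inner ℂ (e' (σ x)) (e' (σ y)) = inner ℂ (e x) (e y))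
    (he : (Submodule.span ℂ (Set.range e)).topologicalClosure = ⊤)
    (he' : (Submodule.span ℂ (Set.range e')).topologicalClosure = ⊤) :
    ∃ U : H ≃ₗᵢ[ℂ] H', ∀ x, U (e x) = e' (σ x) := by
  -- The norm of a finite combination depends only on the Gram kernel, so relabelling by `σ`
  -- preserves it and extends from the dense ranges.
  have hnorm : ∀ c, ‖Finsupp.linearCombination ℂ e' (Finsupp.domLCongr (R := ℂ) σ c)‖ =
      ‖Finsupp.linearCombination ℂ e c‖ := by
    intro c
    have h1 : Finsupp.linearCombination ℂ e' (Finsupp.domLCongr (R := ℂ) σ c) =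
        c.sum fun x t => t • e' (σ x) := by
      simp [Finsupp.linearCombination_apply, Finsupp.equivMapDomain_eq_mapDomain,
        Finsupp.sum_mapDomain_index, add_smul]
    rw [← sq_eq_sq₀ (norm_nonneg _) (norm_nonneg _), ← inner_self_eq_norm_sq (𝕜 := ℂ),
      ← inner_self_eq_norm_sq (𝕜 := ℂ), h1, Finsupp.linearCombination_apply]
    simp only [Finsupp.sum, sum_inner, inner_sum, inner_smul_left, inner_smul_right, hin]
  have hd := denseRange_linearCombination he
  have hd' := denseRange_linearCombination he'
  refine ⟨LinearEquiv.extendOfIsometry (Finsupp.domLCongr (R := ℂ) (M := ℂ) σ)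
    (Finsupp.linearCombination ℂ e) (Finsupp.linearCombination ℂ e') hd hd' hnorm, fun x => ?_⟩
  have := LinearEquiv.extendOfIsometry_eq (Finsupp.domLCongr (R := ℂ) (M := ℂ) σ)
    (Finsupp.linearCombination ℂ e) (Finsupp.linearCombination ℂ e') hd hd' hnorm
    (Finsupp.single x 1)
  simpa using this

/-! ### GNS families and left translation. -/

namespace TopologicalGroupoid

/-- A Gelfand-Naimark-Segal family of a function `φ` on a groupoid: Hilbert spaces `H a` spanned by
vectors `e a x`, `r x = a`, with `⟪e a x, e a y⟫ = φ (y⁻¹ x)`, on which the groupoid acts by left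
translation. -/
structure GNSFamily {X : Type u} {G : Type v} [TopologicalSpace X] [TopologicalSpace G]
    (𝒢 : TopologicalGroupoid X G) (φ : G → ℂ) where
  /-- the Hilbert space at a unit -/
  H : X → Type v
  [normedAddCommGroup : ∀ a, NormedAddCommGroup (H a)]
  [innerProductSpace : ∀ a, InnerProductSpace ℂ (H a)]
  [completeSpace : ∀ a, CompleteSpace (H a)]
  /-- the spanning vectors, extended by zero off the fibre -/
  e : ∀ a, G → H a
  e_eq_zero : ∀ a x, 𝒢.r x ≠ a → e a x = 0
  inner_e : ∀ a x y, 𝒢.r x = a → 𝒢.r y = a →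
    inner ℂ (e a x) (e a y) = φ (𝒢.mul (𝒢.inv y) x)
  dense_span : ∀ a, (Submodule.span ℂ (Set.range (e a))).topologicalClosure = ⊤
  /-- left translation -/
  L : ∀ (x : G) {a b : X}, 𝒢.s x = a → 𝒢.r x = b → (H a ≃ₗᵢ[ℂ] H b)
  L_e : ∀ (x : G) {a b : X} (ha : 𝒢.s x = a) (hb : 𝒢.r x = b) (y : G), 𝒢.r y = a →
    L x ha hb (e a y) = e b (𝒢.mul x y)

attribute [instance] GNSFamily.normedAddCommGroup GNSFamily.innerProductSpace
  GNSFamily.completeSpace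

/-- Left translation by a groupoid element as a bijection between fibres. -/
def fiberEquiv {X : Type u} {G : Type v} [TopologicalSpace X] [TopologicalSpace G]
    (𝒢 : TopologicalGroupoid X G) (x : G) {a b : X} (ha : 𝒢.s x = a) (hb : 𝒢.r x = b) :
    {y // 𝒢.r y = a} ≃ {y // 𝒢.r y = b} where
  toFun y := ⟨𝒢.mul x y, (𝒢.r_mul _ _ (ha.trans y.2.symm)).trans hb⟩
  invFun y := ⟨𝒢.mul (𝒢.inv x) y, ((𝒢.r_mul _ _ ((𝒢.s_inv x).trans (hb.trans y.2.symm))).trans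
    (𝒢.r_inv x)).trans ha⟩
  left_inv y := Subtype.ext (𝒢.inv_mul_cancel_left (ha.trans y.2.symm))
  right_inv y := Subtype.ext (𝒢.mul_inv_cancel_left (hb.trans y.2.symm))

theorem IsPositiveDefinite.nonempty_gnsFamily {X : Type u} {G : Type v} [TopologicalSpace X]
    [TopologicalSpace G] [LocallyCompactSpace G] [T2Space G] [SecondCountableTopology G]
    [MeasurableSpace G] [BorelSpace G] {𝒢 : TopologicalGroupoid X G} {haar : X → Measure G}
    (h : 𝒢.IsHaarSystem haar) {φ : G → ℂ} (hφ : 𝒢.IsPositiveDefinite haar φ) :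
    Nonempty (𝒢.GNSFamily φ) := by
  classical
  choose H i₁ i₂ i₃ e he hd using fun a => exists_inner_eq_kernel (S := {x // 𝒢.r x = a})
    (fun x y => φ (𝒢.mul (𝒢.inv y) x))
    fun n s x c => hφ.sum_nonneg h s (x := fun i => (x i : G)) (fun i => (x i).2) c
  have hU : ∀ (x : G) {a b : X} (ha : 𝒢.s x = a) (hb : 𝒢.r x = b),
      ∃ U : H a ≃ₗᵢ[ℂ] H b, ∀ y, U (e a y) = e b (𝒢.fiberEquiv x ha hb y) := fun x a b ha hb =>
    exists_linearIsometryEquiv_of_inner_eq (𝒢.fiberEquiv x ha hb) (fun y z => by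
      rw [he, he]
      exact congrArg φ (𝒢.inv_mul_mul_mul (ha.trans z.2.symm) (ha.trans y.2.symm))) (hd a) (hd b)
  choose U hUe using hU
  have hval : ∀ a x (hx : 𝒢.r x = a),
      (if hx : 𝒢.r x = a then e a ⟨x, hx⟩ else 0) = e a ⟨x, hx⟩ := fun a x hx => dif_pos hx
  refine ⟨{ H := H, e := fun a x => if hx : 𝒢.r x = a then e a ⟨x, hx⟩ else 0,
            e_eq_zero := fun a x hx => dif_neg hx, inner_e := ?_, dense_span := ?_, L := U,
            L_e := ?_ }⟩
  · intro a x y hx hy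
    rw [hval a x hx, hval a y hy, he]
  · intro a
    rw [eq_top_iff, ← hd a]
    refine Submodule.topologicalClosure_mono (Submodule.span_mono ?_)
    rintro _ ⟨x, rfl⟩
    exact ⟨x, hval a x x.2⟩
  · intro x a b ha hb y hy
    rw [hval a y hy, hUe, hval b _ ((𝒢.r_mul x y (ha.trans hy.symm)).trans hb)]
    rfl

namespace GNSFamily

section Basic

variable {X : Type u} {G : Type v} [TopologicalSpace X] [TopologicalSpace G]
  {𝒢 : TopologicalGroupoid X G} {φ : G → ℂ} (D : 𝒢.GNSFamily φ)

/-- The spanning vectors determine a bounded operator, so identities between translations reduce to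
identities in the groupoid. -/
theorem eq_of_eqOn {a : X} {E : Type*} [NormedAddCommGroup E] [NormedSpace ℂ E]
    {S T : D.H a →L[ℂ] E} (hST : ∀ x, 𝒢.r x = a → S (D.e a x) = T (D.e a x)) : S = T := by
  refine ContinuousLinearMap.ext_on (s := Set.range (D.e a))
    (Submodule.dense_iff_topologicalClosure_eq_top.2 (D.dense_span a)) ?_
  rintro _ ⟨x, rfl⟩
  by_cases hx : 𝒢.r x = a
  · exact hST x hx
  · simp [D.e_eq_zero a x hx]

/-- The product enters as a separate `z` with an equation, so that no transport is needed when the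
action is pulled back along a homomorphism. -/
theorem L_mul {x y z : G} (hz : z = 𝒢.mul x y) {a b c : X} (hya : 𝒢.s y = a) (hyb : 𝒢.r y = b)
    (hxb : 𝒢.s x = b) (hxc : 𝒢.r x = c) (hza : 𝒢.s z = a) (hzc : 𝒢.r z = c) (t : D.H a) :
    D.L z hza hzc t = D.L x hxb hxc (D.L y hya hyb t) := by
  have := D.eq_of_eqOn (S := (D.L z hza hzc : D.H a →L[ℂ] D.H c))
    (T := (D.L x hxb hxc : D.H b →L[ℂ] D.H c) ∘L (D.L y hya hyb : D.H a →L[ℂ] D.H b))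
    fun w hw => by
      have hw' := hya.trans hw.symm
      change D.L z hza hzc (D.e a w) = D.L x hxb hxc (D.L y hya hyb (D.e a w))
      rw [D.L_e z hza hzc w hw, D.L_e y hya hyb w hw,
        D.L_e x hxb hxc _ ((𝒢.r_mul y w hw').trans hyb), hz,
        𝒢.mul_assoc x y w (hxb.trans hyb.symm) hw']
  exact DFunLike.congr_fun this t

theorem L_unit (a : X) (t : D.H a) : D.L (𝒢.unit a) (𝒢.s_unit a) (𝒢.r_unit a) t = t := by
  have := D.eq_of_eqOn (S := (D.L (𝒢.unit a) (𝒢.s_unit a) (𝒢.r_unit a) : D.H a →L[ℂ] D.H a))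
    (T := ContinuousLinearMap.id ℂ (D.H a)) fun w hw => by
      change D.L (𝒢.unit a) (𝒢.s_unit a) (𝒢.r_unit a) (D.e a w) = D.e a w
      rw [D.L_e _ _ _ w hw, ← hw, 𝒢.unit_mul]
  exact DFunLike.congr_fun this t

theorem continuousOn_e (hφ : Continuous φ) (a : X) : ContinuousOn (D.e a) {x | 𝒢.r x = a} :=
  𝒢.continuousOn_of_gram hφ (D.inner_e a)

theorem separableSpace [SecondCountableTopology G] (hφ : Continuous φ) (a : X) :
    TopologicalSpace.SeparableSpace (D.H a) := by
  rw [← TopologicalSpace.isSeparable_univ_iff]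
  have h1 : TopologicalSpace.IsSeparable (D.e a '' {x | 𝒢.r x = a}) := by
    rw [Set.image_eq_range]
    exact TopologicalSpace.isSeparable_range
      (continuousOn_iff_continuous_domRestrict.1 (D.continuousOn_e hφ a))
  have h2 : TopologicalSpace.IsSeparable (Set.range (D.e a)) := by
    refine (h1.union (Set.countable_singleton (0 : D.H a)).isSeparable).mono ?_
    rintro _ ⟨x, rfl⟩
    by_cases hx : 𝒢.r x = a
    · exact Or.inl ⟨x, hx, rfl⟩
    · exact Or.inr (D.e_eq_zero a x hx)
  have h3 := (h2.span (R := ℂ)).closure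
  rwa [← Submodule.topologicalClosure_coe, D.dense_span, Submodule.top_coe] at h3

end Basic

/-! ### The vectors `∫ f e` and their continuity in the base point. -/

section Integral

variable {X : Type u} {G : Type v} [TopologicalSpace X] [TopologicalSpace G]
    [MeasurableSpace G]
  {𝒢 : TopologicalGroupoid X G} {φ : G → ℂ} (D : 𝒢.GNSFamily φ)

/-- The vector `∫ f(x) e(x) dλᵃ(x)`. -/
noncomputable def integral (haar : X → Measure G) (f : G → ℂ) (a : X) : D.H a :=
  ∫ x, f x • D.e a x ∂(haar a)

theorem integral_smul (haar : X → Measure G) (c : ℂ) (f : G → ℂ) (a : X) :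
    D.integral haar (c • f) a = c • D.integral haar f a := by
  simp only [GNSFamily.integral, Pi.smul_apply, smul_assoc]
  exact MeasureTheory.integral_smul c _

variable [LocallyCompactSpace G] [T2Space G] [SecondCountableTopology G] [BorelSpace G]
  {haar : X → Measure G}

theorem inner_L_integral_e (h : 𝒢.IsHaarSystem haar) (hφ : Continuous φ) {f : G → ℂ}
    (hf : Continuous f) (hc : HasCompactSupport f) (z : G) {a b : X} (ha : 𝒢.s z = a)
    (hb : 𝒢.r z = b) {y : G} (hy : 𝒢.r y = b) :
    inner ℂ (D.L z ha hb (D.integral haar f a)) (D.e b y) =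
      ∫ x, conj (f x) * φ (𝒢.mul (𝒢.inv y) (𝒢.mul z x)) ∂(haar a) := by
  have hi : Integrable (fun x => f x • D.e a x) (haar a) :=
    h.integrable_smul hf hc (D.continuousOn_e hφ a)
  set T : D.H a →L[ℂ] D.H b := (D.L z ha hb : D.H a →L[ℂ] D.H b) with hT
  have h1 : D.L z ha hb (D.integral haar f a) = ∫ x, T (f x • D.e a x) ∂(haar a) :=
    (T.integral_comp_comm hi).symm
  rw [h1, ← inner_conj_symm, ← integral_inner (T.integrable_comp hi), ← integral_conj]
  refine integral_congr_ae ?_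
  filter_upwards [h.ae_fiber a] with x hx
  have h2 : T (f x • D.e a x) = f x • D.e b (𝒢.mul z x) := by
    rw [map_smul]
    exact congrArg _ (D.L_e z ha hb x hx)
  rw [inner_conj_symm, h2, inner_smul_left,
    D.inner_e b _ _ ((𝒢.r_mul z x (ha.trans hx.symm)).trans hb) hy]

theorem inner_L_integral_integral (h : 𝒢.IsHaarSystem haar) (hφ : Continuous φ) {f g : G → ℂ}
    (hf : Continuous f) (hfc : HasCompactSupport f) (hg : Continuous g)
    (hgc : HasCompactSupport g) (z : G) {a b : X} (ha : 𝒢.s z = a) (hb : 𝒢.r z = b) :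
    inner ℂ (D.L z ha hb (D.integral haar f a)) (D.integral haar g b) =
      ∫ y, g y * ∫ x, conj (f x) * φ (𝒢.mul (𝒢.inv y) (𝒢.mul z x)) ∂(haar a) ∂(haar b) := by
  have hi : Integrable (fun x => g x • D.e b x) (haar b) :=
    h.integrable_smul hg hgc (D.continuousOn_e hφ b)
  refine (integral_inner hi _).symm.trans ?_
  refine integral_congr_ae ?_
  filter_upwards [h.ae_fiber b] with y hy
  rw [inner_smul_right, D.inner_L_integral_e h hφ hf hfc z ha hb hy]

/-- Two nested uses of `continuous_integral_mul`; the inner one is parametrised by the fibred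
product of `Z` and `G`. Taking `w = unit` gives the continuity of inner products of sections, and a
homomorphism as `w` gives that of coefficients. -/
theorem continuous_inner_L_integral (h : 𝒢.IsHaarSystem haar) (hφ : Continuous φ) {f g : G → ℂ}
    (hf : Continuous f) (hfc : HasCompactSupport f) (hg : Continuous g)
    (hgc : HasCompactSupport g) {Z : Type*} [TopologicalSpace Z] {w : Z → G} (hw : Continuous w)
    {p q : Z → X} (hp : ∀ z, 𝒢.s (w z) = p z) (hq : ∀ z, 𝒢.r (w z) = q z) :
    Continuous fun z => (inner ℂ (D.L (w z) (hp z) (hq z) (D.integral haar f (p z)))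
      (D.integral haar g (q z)) : ℂ) := by
  have hpc : Continuous p := by
    rw [← funext hp]; exact 𝒢.continuous_s.comp hw
  have hqc : Continuous q := by
    rw [← funext hq]; exact 𝒢.continuous_r.comp hw
  simp only [D.inner_L_integral_integral h hφ hf hfc hg hgc]
  refine h.continuous_integral_mul hqc (k := fun t : Z × G =>
    ∫ x, conj (f x) * φ (𝒢.mul (𝒢.inv t.2) (𝒢.mul (w t.1) x)) ∂(haar (p t.1))) ?_ hg hgc
  rw [continuousOn_iff_continuous_domRestrict]
  refine h.continuous_integral_mul (Z := {t : Z × G | 𝒢.r t.2 = q t.1}) (p := fun t => p t.1.1)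
    (by fun_prop) (k := fun s => φ (𝒢.mul (𝒢.inv s.1.1.2) (𝒢.mul (w s.1.1.1) s.2))) ?_
    (f := fun x => conj (f x)) (by fun_prop) (hfc.comp_left (g := conj) (map_zero _))
  refine hφ.comp_continuousOn (𝒢.continuousOn_inv_mul.comp
    (f := fun s : {t : Z × G | 𝒢.r t.2 = q t.1} × G => (s.1.1.2, 𝒢.mul (w s.1.1.1) s.2))
    (ContinuousOn.prodMk (by fun_prop) (𝒢.continuousOn_mul.comp
      (f := fun s : {t : Z × G | 𝒢.r t.2 = q t.1} × G => (w s.1.1.1, s.2)) (by fun_prop) ?_)) ?_)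
  · intro s hs
    exact (hp _).trans (Eq.symm hs)
  · intro s hs
    have h1 : 𝒢.s (w s.1.1.1) = 𝒢.r s.2 := (hp _).trans (Eq.symm hs)
    exact (s.1.2.trans (hq _).symm).trans (𝒢.r_mul _ _ h1).symm

theorem continuous_inner_integral (h : 𝒢.IsHaarSystem haar) (hφ : Continuous φ) {f g : G → ℂ}
    (hf : Continuous f) (hfc : HasCompactSupport f) (hg : Continuous g)
    (hgc : HasCompactSupport g) :
    Continuous fun a => (inner ℂ (D.integral haar f a) (D.integral haar g a) : ℂ) := by
  have := D.continuous_inner_L_integral h hφ hf hfc hg hgc 𝒢.continuous_unit 𝒢.s_unit 𝒢.r_unit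
  simpa only [D.L_unit] using this

theorem continuous_norm_integral (h : 𝒢.IsHaarSystem haar) (hφ : Continuous φ) {f : G → ℂ}
    (hf : Continuous f) (hfc : HasCompactSupport f) :
    Continuous fun a => ‖D.integral haar f a‖ := by
  simp only [norm_eq_sqrt_re_inner (𝕜 := ℂ)]
  exact Real.continuous_sqrt.comp
    (RCLike.continuous_re.comp (D.continuous_inner_integral h hφ hf hfc hf hfc))

theorem continuous_norm_integral_sub_e (h : 𝒢.IsHaarSystem haar) (hφ : Continuous φ) {f : G → ℂ}
    (hf : Continuous f) (hfc : HasCompactSupport f) {Z : Type*} [TopologicalSpace Z] {w : Z → G}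
    (hw : Continuous w) {p : Z → X} (hp : ∀ z, 𝒢.r (w z) = p z) :
    Continuous fun z => ‖D.integral haar f (p z) - D.e (p z) (w z)‖ := by
  have hpc : Continuous p := by
    rw [← funext hp]; exact 𝒢.continuous_r.comp hw
  have h1 : Continuous fun z => (inner ℂ (D.integral haar f (p z)) (D.e (p z) (w z)) : ℂ) := by
    have : ∀ z, (inner ℂ (D.integral haar f (p z)) (D.e (p z) (w z)) : ℂ) =
        ∫ x, conj (f x) * φ (𝒢.mul (𝒢.inv (w z)) x) ∂(haar (p z)) := by
      intro z
      have := D.inner_L_integral_e h hφ hf hfc (𝒢.unit (p z)) (𝒢.s_unit _) (𝒢.r_unit _) (hp z)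
      rw [D.L_unit] at this
      rw [this]
      refine integral_congr_ae ?_
      filter_upwards [h.ae_fiber (p z)] with x hx
      rw [← hx, 𝒢.unit_mul]
    simp only [this]
    refine h.continuous_integral_mul hpc (k := fun t => φ (𝒢.mul (𝒢.inv (w t.1)) t.2)) ?_
      (f := fun x => conj (f x)) (by fun_prop) (hfc.comp_left (g := conj) (map_zero _))
    exact hφ.comp_continuousOn (𝒢.continuousOn_inv_mul.comp
      (f := fun t : Z × G => (w t.1, t.2)) (by fun_prop) fun t ht => (hp _).trans (Eq.symm ht))
  have h2 : Continuous fun z => (inner ℂ (D.e (p z) (w z)) (D.e (p z) (w z)) : ℂ) := by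
    have : ∀ z, (inner ℂ (D.e (p z) (w z)) (D.e (p z) (w z)) : ℂ) = φ (𝒢.unit (𝒢.s (w z))) :=
      fun z => by rw [D.inner_e _ _ _ (hp z) (hp z), 𝒢.inv_mul]
    simp only [this]
    exact hφ.comp (𝒢.continuous_unit.comp (𝒢.continuous_s.comp hw))
  -- Expand the squared norm: the cross term is a fibre integral of `φ`, and the last is `φ` at a
  -- unit.
  have h3 : ∀ z, ‖D.integral haar f (p z) - D.e (p z) (w z)‖ =
      √(‖D.integral haar f (p z)‖ ^ 2 -
        2 * RCLike.re (inner ℂ (D.integral haar f (p z)) (D.e (p z) (w z)) : ℂ) +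
        RCLike.re (inner ℂ (D.e (p z) (w z)) (D.e (p z) (w z)) : ℂ)) := by
    intro z
    rw [inner_self_eq_norm_sq, ← norm_sub_sq, Real.sqrt_sq (norm_nonneg _)]
  simp only [h3]
  exact Real.continuous_sqrt.comp (((((D.continuous_norm_integral h hφ hf hfc).comp hpc).pow 2).sub
    (continuous_const.mul (RCLike.continuous_re.comp h1))).add (RCLike.continuous_re.comp h2))

theorem exists_norm_integral_sub_e_lt (h : 𝒢.IsHaarSystem haar) (hφ : Continuous φ) {a : X}
    {x₀ : G} (hx₀ : 𝒢.r x₀ = a) {ε : ℝ} (hε : 0 < ε) :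
    ∃ f : G → ℂ, Continuous f ∧ HasCompactSupport f ∧
      ‖D.integral haar f a - D.e a x₀‖ < ε := by
  have hc := D.continuousOn_e hφ a
  have hev := Metric.tendsto_nhds.1 (hc x₀ hx₀) (ε / 2) (half_pos hε)
  rw [eventually_nhdsWithin_iff] at hev
  obtain ⟨g, hg, hgc, hg0, hgU, hg1⟩ := h.exists_bump hx₀ hev
  refine ⟨fun x => (g x : ℂ), Complex.continuous_ofReal.comp hg,
    hgc.comp_left (g := fun t : ℝ => (t : ℂ)) Complex.ofReal_zero, ?_⟩
  refine lt_of_le_of_lt ?_ (half_lt_self hε)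
  have := h.norm_integral_smul_sub_le hg hgc hg0 hg1 hc (e := D.e a x₀) (δ := ε / 2) ?_
  · simpa only [GNSFamily.integral, Complex.coe_smul] using this
  · intro x hx hgx
    have hxU : x ∈ {x | x ∈ {x | 𝒢.r x = a} → dist (D.e a x) (D.e a x₀) < ε / 2} := by
      by_contra hn
      exact hgx (hgU x hn)
    rw [← dist_eq_norm]
    exact (hxU hx).le

theorem integral_add (h : 𝒢.IsHaarSystem haar) (hφ : Continuous φ) {f g : G → ℂ}
    (hf : Continuous f) (hfc : HasCompactSupport f) (hg : Continuous g)
    (hgc : HasCompactSupport g) (a : X) :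
    D.integral haar (f + g) a = D.integral haar f a + D.integral haar g a := by
  simp only [GNSFamily.integral, Pi.add_apply, add_smul]
  exact MeasureTheory.integral_add (h.integrable_smul hf hfc (D.continuousOn_e hφ a))
    (h.integrable_smul hg hgc (D.continuousOn_e hφ a))

/-- These integrals form a subspace whose closure contains every `e a x`, by shrinking bumps at `x`.
-/
theorem dense_integral (h : 𝒢.IsHaarSystem haar) (hφ : Continuous φ) (a : X) :
    Dense {t : D.H a | ∃ f : G → ℂ, Continuous f ∧ HasCompactSupport f ∧
      D.integral haar f a = t} := by
  let M : Submodule ℂ (D.H a) :=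
    { carrier := {t | ∃ f : G → ℂ, Continuous f ∧ HasCompactSupport f ∧ D.integral haar f a = t}
      zero_mem' := ⟨0, continuous_zero, HasCompactSupport.zero, by simp [GNSFamily.integral]⟩
      add_mem' := by
        rintro _ _ ⟨f, hf, hfc, rfl⟩ ⟨g, hg, hgc, rfl⟩
        exact ⟨f + g, hf.add hg, hfc.add hgc, D.integral_add h hφ hf hfc hg hgc a⟩
      smul_mem' := by
        rintro c _ ⟨f, hf, hfc, rfl⟩
        exact ⟨c • f, hf.const_smul c, hfc.smul_left (f := fun _ => c), D.integral_smul haar c f a⟩ }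
  change Dense (M : Set (D.H a))
  rw [Submodule.dense_iff_topologicalClosure_eq_top, eq_top_iff, ← D.dense_span a]
  refine Submodule.topologicalClosure_minimal _ (Submodule.span_le.2 ?_)
    M.isClosed_topologicalClosure
  rintro _ ⟨x, rfl⟩
  by_cases hx : 𝒢.r x = a
  · change D.e a x ∈ closure (M : Set (D.H a))
    rw [Metric.mem_closure_iff]
    intro ε hε
    obtain ⟨f, hf, hfc, hfe⟩ := D.exists_norm_integral_sub_e_lt h hφ hx hε
    exact ⟨_, ⟨f, hf, hfc, rfl⟩, by rwa [dist_comm, dist_eq_norm]⟩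
  · rw [D.e_eq_zero a x hx]
    exact Submodule.zero_mem _

end Integral

end GNSFamily

end TopologicalGroupoid

/-! ### The continuous field and the pulled back bundle. -/

namespace TopologicalGroupoid

namespace GNSFamily

section Bundle

variable {X₀ : Type u} {X : Type w} {G : Type v} [TopologicalSpace X₀] [TopologicalSpace X]
  [TopologicalSpace G] [MeasurableSpace G] [LocallyCompactSpace G] [T2Space G]
  [SecondCountableTopology G] [BorelSpace G]
  {𝒢 : TopologicalGroupoid X G} {φ : G → ℂ} (D : 𝒢.GNSFamily φ) {haar : X → Measure G}

/-- The continuous sections of the pulled back Gelfand-Naimark-Segal bundle: the local uniform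
limits of the sections `∫ f(x) e(x) dλ(x)`, `f` continuous with compact support. -/
def continuousSections (h : 𝒢.IsHaarSystem haar) (hφ : Continuous φ) (p : X₀ → X) :
    Submodule ℂ (∀ a, D.H (p a)) where
  carrier := {ξ | ∀ a, ∀ ε : ℝ, 0 < ε → ∃ f : G → ℂ, Continuous f ∧ HasCompactSupport f ∧
    ∀ᶠ b in 𝓝 a, ‖ξ b - D.integral haar f (p b)‖ ≤ ε}
  zero_mem' a ε hε := ⟨0, continuous_zero, HasCompactSupport.zero,
    Filter.Eventually.of_forall fun b => by simp [GNSFamily.integral, hε.le]⟩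
  add_mem' := by
    intro ξ η hξ hη a ε hε
    obtain ⟨f, hf, hfc, hfe⟩ := hξ a (ε / 2) (half_pos hε)
    obtain ⟨g, hg, hgc, hge⟩ := hη a (ε / 2) (half_pos hε)
    refine ⟨f + g, hf.add hg, hfc.add hgc, ?_⟩
    filter_upwards [hfe, hge] with b hb hb'
    rw [D.integral_add h hφ hf hfc hg hgc, Pi.add_apply, add_sub_add_comm]
    exact (norm_add_le_of_le hb hb').trans (add_halves ε).le
  smul_mem' := by
    intro c ξ hξ a ε hε
    obtain ⟨f, hf, hfc, hfe⟩ := hξ a (ε / (‖c‖ + 1)) (by positivity)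
    refine ⟨c • f, hf.const_smul c, hfc.smul_left (f := fun _ => c), ?_⟩
    filter_upwards [hfe] with b hb
    rw [D.integral_smul, Pi.smul_apply, ← smul_sub, norm_smul]
    rw [le_div_iff₀ (by positivity)] at hb
    nlinarith [norm_nonneg (ξ b - D.integral haar f (p b))]

theorem integral_mem_continuousSections (h : 𝒢.IsHaarSystem haar) (hφ : Continuous φ)
    (p : X₀ → X) {f : G → ℂ} (hf : Continuous f) (hfc : HasCompactSupport f) :
    (fun a => D.integral haar f (p a)) ∈ D.continuousSections h hφ p := fun a ε hε =>
  ⟨f, hf, hfc, Filter.Eventually.of_forall fun b => by simp [hε.le]⟩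

/-- An integral section close to `e` at one point stays close nearby, since the norm of the
difference is continuous. This provides the two sections that realise `φ`. -/
theorem e_mem_continuousSections (h : 𝒢.IsHaarSystem haar) (hφ : Continuous φ)
    {p : X₀ → X} {w : X₀ → G} (hw : Continuous w) (hp : ∀ a, 𝒢.r (w a) = p a) :
    (fun a => D.e (p a) (w a)) ∈ D.continuousSections h hφ p := by
  intro a ε hε
  obtain ⟨f, hf, hfc, hfe⟩ := D.exists_norm_integral_sub_e_lt h hφ (hp a) hε
  refine ⟨f, hf, hfc, ?_⟩
  filter_upwards [(D.continuous_norm_integral_sub_e h hφ hf hfc hw hp).continuousAt.eventually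
    (gt_mem_nhds hfe)] with b hb
  rw [norm_sub_rev]
  exact hb.le

/-- The pullback along a continuous map of unit spaces of the Gelfand-Naimark-Segal bundle. -/
def hilbertBundle (h : 𝒢.IsHaarSystem haar) (hφ : Continuous φ) {p : X₀ → X}
    (hp : Continuous p) : HilbertBundle.{u, v} X₀ where
  fiber a := D.H (p a)
  separableSpace a := D.separableSpace hφ (p a)
  sections := D.continuousSections h hφ p
  dense_sections a := by
    refine (D.dense_integral h hφ (p a)).mono ?_
    rintro _ ⟨f, hf, hfc, rfl⟩
    exact ⟨_, D.integral_mem_continuousSections h hφ p hf hfc, rfl⟩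
  continuous_norm := by
    intro ξ hξ
    rw [continuous_iff_continuousAt]
    intro a
    rw [ContinuousAt, Metric.tendsto_nhds]
    intro ε hε
    obtain ⟨f, hf, hfc, hfe⟩ := hξ a (ε / 4) (by positivity)
    have hc := ((D.continuous_norm_integral h hφ hf hfc).comp hp).continuousAt (x := a)
    filter_upwards [hfe, Metric.tendsto_nhds.1 hc (ε / 4) (by positivity)] with b hb hb'
    have h1 := abs_le.1 ((abs_norm_sub_norm_le _ _).trans hb)
    have h2 := abs_le.1 ((abs_norm_sub_norm_le _ _).trans hfe.self_of_nhds)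
    rw [Real.dist_eq, abs_lt] at hb' ⊢
    simp only [Function.comp_apply] at hb'
    constructor <;> linarith [hb'.1, hb'.2, h1.1, h1.2, h2.1, h2.2]
  mem_of_locally_approx := by
    intro ξ hξ a ε hε
    obtain ⟨η, hη, hηe⟩ := hξ a (ε / 2) (half_pos hε)
    obtain ⟨f, hf, hfc, hfe⟩ := hη a (ε / 2) (half_pos hε)
    refine ⟨f, hf, hfc, ?_⟩
    filter_upwards [hηe, hfe] with b hb hb'
    exact (norm_sub_le_norm_sub_add_norm_sub _ (η b) _).trans
      ((add_le_add hb hb').trans (add_halves ε).le)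

variable {G₀ : Type*} [TopologicalSpace G₀] (𝒢₀ : TopologicalGroupoid X₀ G₀)

/-- Since `L` is isometric and the sections are bounded, the coefficient is a local uniform limit of
coefficients of integral sections. -/
theorem continuous_inner_L_of_mem (h : 𝒢.IsHaarSystem haar) (hφ : Continuous φ) {p : X₀ → X}
    {j : G₀ → G} (hj : Continuous j) (hs : ∀ x, 𝒢.s (j x) = p (𝒢₀.s x))
    (hr : ∀ x, 𝒢.r (j x) = p (𝒢₀.r x)) {ξ η : ∀ a, D.H (p a)}
    (hξ : ξ ∈ D.continuousSections h hφ p) (hη : η ∈ D.continuousSections h hφ p)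
    {C : ℝ} (hξC : ∀ a, ‖ξ a‖ ≤ C) (hηC : ∀ a, ‖η a‖ ≤ C) :
    Continuous fun x => (inner ℂ (D.L (j x) (hs x) (hr x) (ξ (𝒢₀.s x))) (η (𝒢₀.r x)) : ℂ) := by
  refine continuous_of_locally_uniform_approx_of_continuousAt fun x u hu => ?_
  obtain ⟨ε, hε, hεu⟩ := Metric.mem_uniformity_dist.1 hu
  have hC : 0 ≤ C := (norm_nonneg _).trans (hξC (𝒢₀.s x))
  -- The total error is at most `δ * (2 * C + δ)`; with `δ ≤ 1` this is strictly less than `δ * (2 *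
  -- C + 2) ≤ ε`.
  set δ : ℝ := min 1 (ε / (2 * C + 2)) with hδ
  have hδ0 : 0 < δ := lt_min one_pos (by positivity)
  have hδ1 : δ ≤ 1 := min_le_left _ _
  have hδε : δ * (2 * C + 2) ≤ ε := (le_div_iff₀ (by positivity)).1 (min_le_right _ _)
  obtain ⟨f, hf, hfc, hfe⟩ := hξ (𝒢₀.s x) δ hδ0
  obtain ⟨g, hg, hgc, hge⟩ := hη (𝒢₀.r x) δ hδ0
  refine ⟨_, Filter.inter_mem (𝒢₀.continuous_s.continuousAt.preimage_mem_nhds hfe)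
    (𝒢₀.continuous_r.continuousAt.preimage_mem_nhds hge), _,
    (D.continuous_inner_L_integral h hφ hf hfc hg hgc hj hs hr).continuousAt, ?_⟩
  rintro y ⟨hy1, hy2⟩
  replace hy1 : ‖ξ (𝒢₀.s y) - D.integral haar f (p (𝒢₀.s y))‖ ≤ δ := hy1
  replace hy2 : ‖η (𝒢₀.r y) - D.integral haar g (p (𝒢₀.r y))‖ ≤ δ := hy2
  apply hεu
  set U := D.L (j y) (hs y) (hr y)
  set s₁ := ξ (𝒢₀.s y) with hs₁
  set s₂ := D.integral haar f (p (𝒢₀.s y))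
  set t₁ := η (𝒢₀.r y) with ht₁
  set t₂ := D.integral haar g (p (𝒢₀.r y))
  have h1 : ‖t₁‖ ≤ C := hηC _
  have h2 : ‖s₂‖ ≤ C + δ := by
    calc ‖s₂‖ = ‖s₁ - (s₁ - s₂)‖ := by rw [sub_sub_cancel]
      _ ≤ C + δ := norm_sub_le_of_le (hξC _) hy1
  have hsplit : (inner ℂ (U s₁) t₁ : ℂ) - inner ℂ (U s₂) t₂ =
      inner ℂ (U (s₁ - s₂)) t₁ + inner ℂ (U s₂) (t₁ - t₂) := by
    rw [map_sub, inner_sub_left, inner_sub_right]; ring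
  rw [dist_eq_norm, hsplit]
  calc _ ≤ ‖U (s₁ - s₂)‖ * ‖t₁‖ + ‖U s₂‖ * ‖t₁ - t₂‖ :=
        norm_add_le_of_le (norm_inner_le_norm _ _) (norm_inner_le_norm _ _)
    _ ≤ δ * C + (C + δ) * δ := by
        rw [U.norm_map, U.norm_map]
        gcongr
    _ < ε := by nlinarith

/-- The pullback along a continuous groupoid homomorphism of the Gelfand-Naimark-Segal bundle. -/
def gHilbertBundle (h : 𝒢.IsHaarSystem haar) (hφ : Continuous φ) {p : X₀ → X}
    (hp : Continuous p) {j : G₀ → G} (hj : Continuous j) (hs : ∀ x, 𝒢.s (j x) = p (𝒢₀.s x))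
    (hr : ∀ x, 𝒢.r (j x) = p (𝒢₀.r x))
    (hm : ∀ x y, 𝒢₀.s x = 𝒢₀.r y → j (𝒢₀.mul x y) = 𝒢.mul (j x) (j y)) :
    GHilbertBundle.{u, _, v} 𝒢₀ where
  toHilbertBundle := D.hilbertBundle h hφ hp
  L x _ _ ha hb := D.L (j x) ((hs x).trans (congrArg p ha)) ((hr x).trans (congrArg p hb))
  L_mul x y _ _ _ _ hyb hxb _ t := D.L_mul (hm x y (hxb.trans hyb.symm)) _ _ _ _ _ _ t
  continuous_coefficient := by
    rintro ξ ⟨hξ, C, hC⟩ η ⟨hη, C', hC'⟩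
    exact D.continuous_inner_L_of_mem 𝒢₀ h hφ hj hs hr hξ hη (C := max C C')
      (fun a => (hC a).trans (le_max_left _ _)) fun a => (hC' a).trans (le_max_right _ _)

end Bundle

end GNSFamily

end TopologicalGroupoid

/-! ### Coefficients of a bundle as Gram kernels. -/

namespace GHilbertBundle

section Coefficient

variable {X : Type u} {G : Type v} [TopologicalSpace X] [TopologicalSpace G]
  {𝒢 : TopologicalGroupoid X G} (E : GHilbertBundle.{u, v, w} 𝒢)

theorem L_congr {x y : G} (hxy : x = y) {a b : X} (hxa : 𝒢.s x = a) (hxb : 𝒢.r x = b)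
    (hya : 𝒢.s y = a) (hyb : 𝒢.r y = b) (t : E.fiber a) : E.L x hxa hxb t = E.L y hya hyb t := by
  subst hxy
  rfl

theorem L_unit (a : X) (t : E.fiber a) :
    E.L (𝒢.unit a) (𝒢.s_unit a) (𝒢.r_unit a) t = t := by
  apply (E.L (𝒢.unit a) (𝒢.s_unit a) (𝒢.r_unit a)).injective
  rw [← E.L_mul]
  exact E.L_congr (𝒢.unit_mul_unit a) _ _ _ _ t

theorem L_L_inv (x : G) {a b : X} (ha : 𝒢.s x = a) (hb : 𝒢.r x = b) (t : E.fiber b) :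
    E.L x ha hb (E.L (𝒢.inv x) ((𝒢.s_inv x).trans hb) ((𝒢.r_inv x).trans ha) t) = t := by
  subst hb
  rw [← E.L_mul]
  exact (E.L_congr (𝒢.mul_inv x) _ _ _ _ t).trans (E.L_unit _ t)

theorem coefficient_eq (ξ η : ∀ a, E.fiber a) (x : G) {a b : X} (ha : 𝒢.s x = a)
    (hb : 𝒢.r x = b) : E.coefficient ξ η x = inner ℂ (E.L x ha hb (ξ a)) (η b) := by
  subst ha hb
  rfl

/-- Apply the isometry `L y` to both sides of the inner product defining the coefficient at `y⁻¹ x`.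
This is the Gram identity behind positivity. -/
theorem inner_L_L (ξ η : ∀ a, E.fiber a) {x y : G} {a : X} (hx : 𝒢.r x = a) (hy : 𝒢.r y = a) :
    inner ℂ (E.L x rfl hx (ξ (𝒢.s x))) (E.L y rfl hy (η (𝒢.s y))) =
      E.coefficient ξ η (𝒢.mul (𝒢.inv y) x) := by
  have h : 𝒢.s (𝒢.inv y) = 𝒢.r x := (𝒢.s_inv y).trans (hy.trans hx.symm)
  rw [E.coefficient_eq ξ η _ (𝒢.s_mul _ _ h) ((𝒢.r_mul _ _ h).trans (𝒢.r_inv y)),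
    E.L_mul (𝒢.inv y) x rfl hx ((𝒢.s_inv y).trans hy) (𝒢.r_inv y),
    ← (E.L y rfl hy).inner_map_map, E.L_L_inv]

theorem norm_coefficient_le {ξ η : ∀ a, E.fiber a} {C C' : ℝ} (hξ : ∀ a, ‖ξ a‖ ≤ C)
    (hη : ∀ a, ‖η a‖ ≤ C') (x : G) : ‖E.coefficient ξ η x‖ ≤ C * C' := by
  refine (norm_inner_le_norm _ _).trans ?_
  rw [LinearIsometryEquiv.norm_map]
  exact mul_le_mul (hξ _) (hη _) (norm_nonneg _) ((norm_nonneg _).trans (hξ (𝒢.s x)))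

theorem adjoint_coefficient (ξ η : ∀ a, E.fiber a) :
    𝒢.adjoint (E.coefficient ξ η) = E.coefficient η ξ := by
  ext x
  rw [TopologicalGroupoid.adjoint, E.coefficient_eq ξ η _ (𝒢.s_inv x) (𝒢.r_inv x), inner_conj_symm,
    ← (E.L x rfl rfl).inner_map_map, E.L_L_inv, coefficient]

variable [LocallyCompactSpace G] [T2Space G] [SecondCountableTopology G]
  [MeasurableSpace G] [BorelSpace G] {haar : X → Measure G}

theorem isPositiveDefinite_coefficient_self (h : 𝒢.IsHaarSystem haar) {ξ : ∀ a, E.fiber a}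
    (hξ : ξ ∈ E.boundedSections) : 𝒢.IsPositiveDefinite haar (E.coefficient ξ ξ) := by
  classical
  have hc : Continuous (E.coefficient ξ ξ) := E.continuous_coefficient ξ hξ ξ hξ
  obtain ⟨C, hC⟩ := hξ.2
  refine ⟨hc, ⟨C * C, E.norm_coefficient_le hC hC⟩, fun a f hf hfc => ?_⟩
  refine h.integral_integral_nonneg_of_gram hc
    (e := fun x => if hx : 𝒢.r x = a then E.L x rfl hx (ξ (𝒢.s x)) else 0) ?_ hf hfc
  intro x y hx hy
  rw [dif_pos hx, dif_pos hy, E.inner_L_L]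

/-- The matrix of the coefficients of a family of two sections is positive definite on `G × I₂`. -/
theorem isPositiveDefinite_coefficient_prod (h : 𝒢.IsHaarSystem haar)
    {ξ : Fin 2 → ∀ a, E.fiber a} (hξ : ∀ i, ξ i ∈ E.boundedSections) :
    (𝒢.prod (TopologicalGroupoid.pair (Fin 2))).IsPositiveDefinite
      (TopologicalGroupoid.prodHaar haar (TopologicalGroupoid.pairHaar (Fin 2)))
      fun q => E.coefficient (ξ q.2.2) (ξ q.2.1) q.1 := by
  classical
  have hc : Continuous fun q : G × (Fin 2 × Fin 2) => E.coefficient (ξ q.2.2) (ξ q.2.1) q.1 :=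
    continuous_prod_of_discrete_right.2 fun q =>
      E.continuous_coefficient (ξ q.2) (hξ _) (ξ q.1) (hξ _)
  choose C hC using fun i => (hξ i).2
  refine ⟨hc, ⟨max (C 0) (C 1) * max (C 0) (C 1), fun q => ?_⟩, fun a f hf hfc => ?_⟩
  · have hC' : ∀ i a, ‖ξ i a‖ ≤ max (C 0) (C 1) := by
      intro i a
      fin_cases i
      · exact (hC 0 a).trans (le_max_left _ _)
      · exact (hC 1 a).trans (le_max_right _ _)
    exact E.norm_coefficient_le (hC' _) (hC' _) _
  -- The vector at `(x, (i, j))` depends on `j` only: since `(i, l)⁻¹ (i, j) = (l, j)`, the common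
  -- range index `i` drops out of the kernel.
  · refine h.prod_pair.integral_integral_nonneg_of_gram hc
      (e := fun x => if hx : 𝒢.r x.1 = a.1 then E.L x.1 rfl hx (ξ x.2.2 (𝒢.s x.1)) else 0) ?_ hf hfc
    intro x y hx hy
    have hx' : 𝒢.r x.1 = a.1 := congrArg Prod.fst hx
    have hy' : 𝒢.r y.1 = a.1 := congrArg Prod.fst hy
    rw [dif_pos hx', dif_pos hy', E.inner_L_L]
    rfl

end Coefficient

end GHilbertBundle

/-! ### The off-diagonal corner as a coefficient. -/

namespace TopologicalGroupoid

variable {X : Type u} {G : Type v} [TopologicalSpace X] [TopologicalSpace G]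
  [LocallyCompactSpace G] [T2Space G] [SecondCountableTopology G]
  [MeasurableSpace G] [BorelSpace G]

theorem IsPositiveDefinite.mem_fourierStieltjes {𝒢 : TopologicalGroupoid X G}
    {haar : X → Measure G} (h : 𝒢.IsHaarSystem haar) {F : G × (Fin 2 × Fin 2) → ℂ}
    (hF : (𝒢.prod (pair (Fin 2))).IsPositiveDefinite (prodHaar haar (pairHaar (Fin 2))) F) :
    (fun x => F (x, (0, 1))) ∈ fourierStieltjes 𝒢 := by
  obtain ⟨D⟩ := hF.nonempty_gnsFamily h.prod_pair
  obtain ⟨C, hC⟩ := hF.2.1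
  have hp : Continuous fun a : X => (a, (0 : Fin 2)) := by fun_prop
  have hw : ∀ k : Fin 2, Continuous fun a : X => (𝒢.unit a, ((0 : Fin 2), k)) := fun k =>
    𝒢.continuous_unit.prodMk continuous_const
  have hwr : ∀ (k : Fin 2) (a : X),
      (𝒢.prod (pair (Fin 2))).r (𝒢.unit a, (0, k)) = (a, 0) := fun k a =>
    Prod.ext (𝒢.r_unit a) rfl
  -- Restriction to the corner `G × {(0, 0)}`. The fibre over `(a, 0)` involves both arrows `(0, 0)`
  -- and `(0, 1)`, so one bundle carries both sections.
  let E : GHilbertBundle.{u, v, v} 𝒢 := D.gHilbertBundle 𝒢 h.prod_pair hF.1 hp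
    (j := fun x => (x, (0, 0))) (by fun_prop) (fun _ => rfl) (fun _ => rfl) (fun _ _ _ => rfl)
  have hmem : ∀ k : Fin 2, (fun a : X => D.e (a, 0) (𝒢.unit a, (0, k))) ∈ E.boundedSections := by
    refine fun k => ⟨D.e_mem_continuousSections h.prod_pair hF.1 (hw k) (hwr k), √C, fun a => ?_⟩
    have hnorm : ‖D.e (a, 0) (𝒢.unit a, (0, k))‖ ≤ √C := by
      refine Real.le_sqrt_of_sq_le ?_
      rw [← inner_self_eq_norm_sq (𝕜 := ℂ)]
      refine (RCLike.re_le_norm _).trans ?_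
      rw [D.inner_e _ _ _ (hwr k a) (hwr k a)]
      exact hC _
    exact hnorm
  refine ⟨E, _, hmem 1, _, hmem 0, funext fun x => ?_⟩
  have h1 : (𝒢.prod (pair (Fin 2))).mul (x, (0, 0)) (𝒢.unit (𝒢.s x), (0, 1)) = (x, (0, 1)) :=
    Prod.ext (𝒢.mul_unit x) rfl
  have h2 : (𝒢.prod (pair (Fin 2))).mul
      ((𝒢.prod (pair (Fin 2))).inv (𝒢.unit (𝒢.r x), (0, 0))) (x, (0, 1)) = (x, (0, 1)) := by
    refine Prod.ext ?_ rfl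
    change 𝒢.mul (𝒢.inv (𝒢.unit (𝒢.r x))) x = x
    rw [𝒢.inv_unit, 𝒢.unit_mul]
  have hs : (𝒢.prod (pair (Fin 2))).s (x, (0, 0)) = (𝒢.s x, 0) := rfl
  have hr : ∀ k, (𝒢.prod (pair (Fin 2))).r (x, (0, k)) = (𝒢.r x, 0) := fun _ => rfl
  -- Translation by `(x, (0, 0))` sends `e (unit (s x), (0, 1))` to `e (x, (0, 1))`; pairing with
  -- `e` at `(unit (r x), (0, 0))` evaluates `F` there.
  have h3 : inner ℂ (D.L (x, (0, 0)) hs (hr 0) (D.e (𝒢.s x, 0) (𝒢.unit (𝒢.s x), (0, 1))))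
      (D.e (𝒢.r x, 0) (𝒢.unit (𝒢.r x), (0, 0))) = F (x, (0, 1)) := by
    rw [D.L_e _ hs (hr 0) _ (hwr 1 _), h1, D.inner_e _ _ _ (hr 1) (hwr 0 _), h2]
  exact h3.symm

end TopologicalGroupoid

theorem mainTheorem6 {X : Type u} {G : Type v} [TopologicalSpace X] [TopologicalSpace G]
    [LocallyCompactSpace G] [T2Space G] [SecondCountableTopology G]
    [MeasurableSpace G] [BorelSpace G]
    (𝒢 : TopologicalGroupoid X G) (haar : X → Measure G) (hhaar : 𝒢.IsHaarSystem haar)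
    (φ : G → ℂ) :
    φ ∈ fourierStieltjes 𝒢 ↔
      ∃ F : G × (Fin 2 × Fin 2) → ℂ,
        (𝒢.prod (TopologicalGroupoid.pair (Fin 2))).IsPositiveDefinite
          (TopologicalGroupoid.prodHaar haar (TopologicalGroupoid.pairHaar (Fin 2))) F ∧
        ∃ ρ τ : G → ℂ, 𝒢.IsPositiveDefinite haar ρ ∧ 𝒢.IsPositiveDefinite haar τ ∧
          ∀ x : G, (Matrix.of fun i j : Fin 2 => F (x, (i, j))) =
            !![ρ x, φ x; 𝒢.adjoint φ x, τ x] := by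
  constructor
  · rintro ⟨E, ξ, hξ, η, hη, rfl⟩
    -- The order `![η, ξ]` makes the `(0, 1)` entry the coefficient `(ξ, η)` and the `(1, 0)` entry
    -- `(η, ξ)`, its adjoint.
    refine ⟨_, E.isPositiveDefinite_coefficient_prod hhaar (ξ := ![η, ξ]) ?_,
      _, _, E.isPositiveDefinite_coefficient_self hhaar hη,
      E.isPositiveDefinite_coefficient_self hhaar hξ, fun x => ?_⟩
    · intro i
      fin_cases i
      · exact hη
      · exact hξ
    · rw [E.adjoint_coefficient]
      ext i j
      fin_cases i <;> fin_cases j <;> rfl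
  · rintro ⟨F, hF, ρ, τ, -, -, hm⟩
    have hφ : φ = fun x => F (x, (0, 1)) := funext fun x => (congrFun (congrFun (hm x) 0) 1).symm
    rw [hφ]
    exact hF.mem_fourierStieltjes hhaar
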